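/- Let $K$ be a field. A *non-unital $A_\infty$ category* $\mathcal A$ over $K$ consists of a set of objects, a $\mathbb Z$-graded $K$-vector space $\mathcal A(X,Y)$ for every pair of objects, and, for every $i\ge 1$ and all objects $X_0,\dots,X_i$, a linear map $m_i\colon \mathcal A(X_{i-1},X_i)\otimes\cdots\otimes\mathcal A(X_0,X_1)\to\mathcal A(X_0,X_i)$ of degree $2-i$, such that for every $n\ge1$ $$\sum_{k=1}^{n}\sum_{j=0}^{n-k}(-1)^{jk+(n-j-k)}\,m_{n-k+1}\bigl(\mathrm{id}^{\otimes j}\otimes m_k\otimes\mathrm{id}^{\otimes (n-j-k)}\bigr)=0 .$$ A *non-unital $A_\infty$ functor* $F\colon\mathcal A\to\mathcal B$ consists of a map $F^0$ on objects and, for every $i\ge1$ and all objects $X_0,\dots,X_i$ of $\mathcal A$, a linear map $F^i\colon\mathcal A(X_{i-1},X_i)\otimes\cdots\otimes\mathcal A(X_0,X_1)\to\mathcal B(F^0X_0,F^0X_i)$ of degree $1-i$, such that for every $n\ge1$ $$\sum_{k=1}^{n}\sum_{j=0}^{n-k}(-1)^{jk+(n-j-k)}F^{n-k+1}\bigl(\mathrm{id}^{\otimes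 j}\otimes m_k\otimes\mathrm{id}^{\otimes(n-j-k)}\bigr)=\sum_{r\ge1}\ \sum_{s_1+\dots+s_r=n}(-1)^{\sum_{u}(1-s_u)\sum_{v>u}s_v}\,m_r\bigl(F^{s_r}\otimes\cdots\otimes F^{s_1}\bigr),$$ where all $s_u\ge1$. The composition of $F\colon\mathcal A\to\mathcal B$ and $G\colon\mathcal B\to\mathcal C$ is given by $(G\circ F)^0=G^0\circ F^0$ and $$(G\circ F)^n=\sum_{r\ge1}\ \sum_{s_1+\dots+s_r=n}(-1)^{\sum_{u}(1-s_u)\sum_{v>u}s_v}\,G^r\bigl(F^{s_r}\otimes\cdots\otimes F^{s_1}\bigr).$$ The Koszul sign rule is used throughout. $\mathcal A$ is *strictly unital* if every object $X$ has an $\mathrm{id}_X\in\mathcal A(X,X)$ of degree $0$ with $m_1(\mathrm{id}_X)=0$, $m_2(f,\mathrm{id}_X)=f$ and $m_2(\mathrm{id}_Y,f)=f$ for all $f\in\mathcal A(X,Y)$, and $m_i(\dots,\mathrm{id}_X,\dots)=0$ for $i>2$. A functor $F$ between strictly unital $A_\infty$ categories is *strictly unital* if $F^1(\mathrm{id}_X)=\mathrm{id}_{F^0X}$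 and $F^i(\dots,\mathrm{id}_X,\dots)=0$ for $i>1$. $\mathcal A$ is *cohomologically unital* if its cohomology $H(\mathcal A)$ with respect to $m_1$, with the composition induced by $m_2$, has identities, and a functor $F$ between cohomologically unital $A_\infty$ categories is *cohomologically unital* if $H(F)$ preserves these identities. Let $\mathbf{A_\infty Cat}$ be the category of strictly unital $A_\infty$ categories and functors over $K$, and let $\mathbf{A_\infty Cat^c}$ be the category of cohomologically unital $A_\infty$ categories and functors over $K$. Consider the graded unital $K$-algebras $\mathcal A=K[\varepsilon_1,\varepsilon_2]$, with $\varepsilon_i\varepsilon_j=0$ for all $i,j\in\{1,2\}$ and $\deg\varepsilon_1=\deg\varepsilon_2=0$, and $\mathcal A'=K[\varepsilon]$, with $\varepsilon^2=0$ and $\deg\varepsilon=-1$. Regard them as strictly unital $A_\infty$ categories with one object, where $m_2$ is the product and $m_i=0$ for $i\ne2$. Let $F_1\colon\mathcal A\to\mathcal A'$ be the strictly unital $A_\infty$ functor such that $F_1^1$ is the unital algebra morphism with $F_1^1(\varepsilon_1)=F_1^1(\varepsilon_2)=0$ and $F_1^i=0$ for $i>1$. Let $F_2\colon\mathcal A\to\mathcal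 A'$ be the strictly unital $A_\infty$ functor with $F_2^1=F_1^1$, $F_2^2(\varepsilon_1,\varepsilon_2)=\varepsilon$, $F_2^2(\varepsilon_i,\varepsilon_j)=0$ for $(i,j)\ne(1,2)$, and $F_2^i=0$ for $i>2$. Then: 1. $F_1$ and $F_2$ have no equalizer in $\mathbf{A_\infty Cat}$. 2. $F_1$ and $F_2$ have no equalizer in $\mathbf{A_\infty Cat^c}$. 3. Neither $\mathbf{A_\infty Cat}$ nor $\mathbf{A_\infty Cat^c}$ admits a model structure (that is, neither can be made into a model category in the sense of Quillen, even if model categories are only required to have finite limits and colimits). -/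

import Mathlib

set_option linter.unusedSectionVars false
set_option linter.unusedSimpArgs false

open CategoryTheory

universe u

/-- Composable chains of arrows `X = A₀ ⟶ A₁ ⟶ ⋯ ⟶ Aₙ = Y`. The chain `(fₙ, …, f₁)`, written as
in `fₙ ⊗ ⋯ ⊗ f₁` with the arrow closest to the target on the left, is
`((nil.cons f₁).cons f₂ ⋯).cons fₙ`. -/
inductive Chain {Ob : Type u} (V : Ob → Ob → Type u) : Ob → Ob → Type u
  | nil (X : Ob) : Chain V X X
  | cons {X Y Z : Ob} (p : Chain V X Y) (f : V Y Z) : Chain V X Z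

namespace Chain

variable {Ob : Type u} {V : Ob → Ob → Type u}

/-- The number of arrows of a chain. -/
def length {X Y : Ob} : Chain V X Y → ℕ
  | nil _ => 0
  | cons p _ => p.length + 1

/-- Concatenation: first `p`, then `q`; in tensor notation this is `q ⊗ p`. -/
def append {X Y Z : Ob} (p : Chain V X Y) : Chain V Y Z → Chain V X Z
  | nil _ => p
  | cons q f => (append p q).cons f

/-- Apply `g` to every arrow of a chain. -/
def map (g : ∀ {X Y : Ob}, V X Y → V X Y) {X Y : Ob} : Chain V X Y → Chain V X Y
  | nil X => nil X
  | cons p f => (map g p).cons (g f)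

/-- The sum of `φ a b` over all the ways of writing `p = a.append b`. -/
def sumSplit {M : Type u} [AddCommMonoid M] {X Y : Ob} :
    Chain V X Y → (∀ Z : Ob, Chain V X Z → Chain V Z Y → M) → M
  | nil X, φ => φ X (nil X) (nil X)
  | cons (Z := Z) p f, φ => φ Z (p.cons f) (nil Z) + sumSplit p (fun W a b => φ W a (b.cons f))

/-- Given a function `Φ` of block decompositions of `p.cons f`, the function of block
decompositions of `p` which evaluates `Φ` after adding `f` to the leftmost block
(and is `0` when there is no block). -/
def extendLast {M : Type u} [AddCommMonoid M] {X Y Z : Ob} (f : V Y Z)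
    (Φ : Chain (Chain V) X Z → M) : Chain (Chain V) X Y → M
  | nil _ => 0
  | cons D b => Φ (D.cons (b.cons f))

/-- The sum of `Φ D` over all decompositions `D = (b_r, …, b_1)` of the chain `p` into
consecutive nonempty blocks (a decomposition is a chain of chains): the last arrow `f` of
`p.cons f` is either a block of its own or belongs to the leftmost block of a decomposition
of `p`. -/
def sumBlocks {M : Type u} [AddCommMonoid M] {X Y : Ob} :
    Chain V X Y → (Chain (Chain V) X Y → M) → M
  | nil X, Φ => Φ (nil X)
  | cons (Y := Y) p f, Φ =>
      sumBlocks p (fun D => Φ (D.cons ((nil Y).cons f)) + extendLast f Φ D)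

/-- `φ (fₙ, …, f₁)` is linear in every entry, i.e. it is a linear map on the tensor products. -/
def Multilinear (K : Type u) [Field K] [∀ X Y, AddCommGroup (V X Y)] [∀ X Y, Module K (V X Y)]
    {M : Type u} [AddCommGroup M] [Module K M] {X Y : Ob} (φ : Chain V X Y → M) : Prop :=
  ∀ (Z W : Ob) (a : Chain V X Z) (c : Chain V W Y),
    IsLinearMap K (fun f : V Z W => φ ((a.cons f).append c))

/-! ### Splitting chains -/

@[simp] lemma append_nil {X Y : Ob} (p : Chain V X Y) : p.append (nil Y) = p := rfl
@[simp] lemma append_cons {X Y Z W : Ob} (p : Chain V X Y) (q : Chain V Y Z) (f : V Z W) :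
    p.append (q.cons f) = (p.append q).cons f := rfl
@[simp] lemma length_nil (X : Ob) : (nil X : Chain V X X).length = 0 := rfl
@[simp] lemma length_cons {X Y Z : Ob} (p : Chain V X Y) (f : V Y Z) :
    (p.cons f).length = p.length + 1 := rfl

lemma length_append {X Y Z : Ob} (p : Chain V X Y) (q : Chain V Y Z) :
    (p.append q).length = p.length + q.length := by
  induction q with
  | nil => rfl
  | cons q f ih => simp [ih]; omega

lemma append_assoc {X Y Z W : Ob} (p : Chain V X Y) (q : Chain V Y Z) (r : Chain V Z W) :
    (p.append q).append r = p.append (q.append r) := by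
  induction r with
  | nil => rfl
  | cons r f ih => simp [ih]

section sums

variable {M : Type u} [AddCommMonoid M]

lemma sumSplit_congr {X Y : Ob} (p : Chain V X Y)
    {φ ψ : ∀ Z : Ob, Chain V X Z → Chain V Z Y → M}
    (h : ∀ Z a b, a.append b = p → φ Z a b = ψ Z a b) : sumSplit p φ = sumSplit p ψ := by
  induction p with
  | nil => exact h _ _ _ rfl
  | cons p f ih =>
    simp only [sumSplit]
    rw [h _ _ _ rfl, ih (fun Z a b hab => h _ _ _ (by simp [hab]))]

lemma sumSplit_add {X Y : Ob} (p : Chain V X Y)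
    (φ ψ : ∀ Z : Ob, Chain V X Z → Chain V Z Y → M) :
    sumSplit p (fun Z a b => φ Z a b + ψ Z a b) = sumSplit p φ + sumSplit p ψ := by
  induction p with
  | nil => rfl
  | cons p f ih => simp only [sumSplit, ih]; abel

lemma sumSplit_zero {X Y : Ob} (p : Chain V X Y) :
    sumSplit p (fun _ _ _ => (0 : M)) = 0 := by
  induction p with
  | nil => rfl
  | cons p f ih => simp only [sumSplit, ih, add_zero]

lemma map_sumSplit {N : Type u} [AddCommMonoid N] (g : M →+ N) {X Y : Ob} (p : Chain V X Y)
    (φ : ∀ Z : Ob, Chain V X Z → Chain V Z Y → M) :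
    g (sumSplit p φ) = sumSplit p (fun Z a b => g (φ Z a b)) := by
  induction p with
  | nil => rfl
  | cons p f ih => simp only [sumSplit, map_add, ih]

lemma sumSplit_assoc {X Y : Ob} (p : Chain V X Y)
    (ψ : ∀ Z W : Ob, Chain V X Z → Chain V Z W → Chain V W Y → M) :
    sumSplit p (fun W ab c => sumSplit ab (fun Z a b => ψ Z W a b c)) =
      sumSplit p (fun Z a bc => sumSplit bc (fun W b c => ψ Z W a b c)) := by
  induction p with
  | nil => rfl
  | cons p f ih =>
    simp only [sumSplit, sumSplit_add, ih]
    abel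

lemma sumSplit_append_cons {X Y Z W : Ob} (a : Chain V X Y) (x : V Y Z) (c : Chain V Z W)
    (φ : ∀ T : Ob, Chain V X T → Chain V T W → M) :
    sumSplit ((a.cons x).append c) φ =
      sumSplit c (fun T c₁ c₂ => φ T ((a.cons x).append c₁) c₂) +
      sumSplit a (fun T a₁ a₂ => φ T a₁ ((a₂.cons x).append c)) := by
  induction c with
  | nil => rfl
  | cons c f ih => simp only [append_cons, sumSplit, ih]; abel

lemma sumSplit_map (g : ∀ {X Y : Ob}, V X Y → V X Y) {X Y : Ob} (p : Chain V X Y)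
    (φ : ∀ Z : Ob, Chain V X Z → Chain V Z Y → M) :
    sumSplit (p.map g) φ = sumSplit p (fun Z a b => φ Z (a.map g) (b.map g)) := by
  induction p with
  | nil => rfl
  | cons p f ih => simp only [map, sumSplit, ih]

lemma sumBlocks_congr {X Y : Ob} (p : Chain V X Y) {Φ Ψ : Chain (Chain V) X Y → M}
    (h : ∀ D, Φ D = Ψ D) : sumBlocks p Φ = sumBlocks p Ψ := by
  rw [show Φ = Ψ from funext h]

lemma extendLast_add {X Y Z : Ob} (f : V Y Z) (Φ Ψ : Chain (Chain V) X Z → M)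
    (D : Chain (Chain V) X Y) :
    extendLast f (fun D => Φ D + Ψ D) D = extendLast f Φ D + extendLast f Ψ D := by
  cases D <;> simp [extendLast]

lemma sumBlocks_add {X Y : Ob} (p : Chain V X Y) (Φ Ψ : Chain (Chain V) X Y → M) :
    sumBlocks p (fun D => Φ D + Ψ D) = sumBlocks p Φ + sumBlocks p Ψ := by
  induction p with
  | nil => rfl
  | cons p f ih =>
    simp only [sumBlocks]
    rw [← ih]
    refine sumBlocks_congr _ fun D => ?_
    rw [extendLast_add]; abel

lemma sumBlocks_zero {X Y : Ob} (p : Chain V X Y) :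
    sumBlocks p (fun _ => (0 : M)) = 0 := by
  induction p with
  | nil => rfl
  | cons p f ih =>
    simp only [sumBlocks]
    refine Eq.trans (sumBlocks_congr _ fun D => ?_) ih
    cases D <;> simp [extendLast]

lemma sumBlocks_smul {K : Type u} [Field K] {M : Type u} [AddCommGroup M] [Module K M] {X Y : Ob}
    (p : Chain V X Y) (r : K) (Φ : Chain (Chain V) X Y → M) :
    sumBlocks p (fun D => r • Φ D) = r • sumBlocks p Φ := by
  induction p with
  | nil => rfl
  | cons p f ih =>
    simp only [sumBlocks]
    rw [← ih]
    refine sumBlocks_congr _ fun D => ?_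
    cases D <;> simp [extendLast]

/-- The leftmost block can be split off. -/
lemma sumBlocks_cons {X Y Z : Ob} (p : Chain V X Y) (f : V Y Z) (Φ : Chain (Chain V) X Z → M) :
    sumBlocks (p.cons f) Φ =
      sumSplit p (fun _ a c => sumBlocks a (fun D => Φ (D.cons (c.cons f)))) := by
  induction p generalizing Z with
  | nil => simp [sumBlocks, sumSplit, extendLast]
  | cons p g ih =>
    rw [sumBlocks, sumBlocks_add, sumSplit]
    congr 1
    rw [ih]
    rfl

end sums

/-! ### Sums over block decompositions, without signs -/

section blockSum

variable {Ob' : Type u} {W : Ob' → Ob' → Type u} {o : Ob → Ob'}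
  {M : Type u} [AddCommMonoid M]

/-- Apply `F` to each block. -/
def mapBlocks (F : ∀ {X Y : Ob}, Chain V X Y → W (o X) (o Y)) {X Y : Ob} :
    Chain (Chain V) X Y → Chain W (o X) (o Y)
  | nil X => nil (o X)
  | cons D b => (mapBlocks F D).cons (F b)

/-- The sum of `φ (F b_r, …, F b_1)` over the decompositions of `p` into blocks. -/
def bs (F : ∀ {X Y : Ob}, Chain V X Y → W (o X) (o Y)) {X Y : Ob}
    (φ : Chain W (o X) (o Y) → M) (p : Chain V X Y) : M :=
  sumBlocks p (fun D => φ (mapBlocks F D))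

variable (F : ∀ {X Y : Ob}, Chain V X Y → W (o X) (o Y))

lemma bs_nil {X : Ob} (φ : Chain W (o X) (o X) → M) : bs F φ (nil X) = φ (nil _) := rfl

lemma bs_cons {X Y Z : Ob} (φ : Chain W (o X) (o Z) → M) (p : Chain V X Y) (f : V Y Z) :
    bs F φ (p.cons f) =
      sumSplit p (fun _ a c => bs F (fun q => φ (q.cons (F (c.cons f)))) a) := by
  unfold bs
  rw [sumBlocks_cons]
  rfl

lemma bs_add {X Y : Ob} (φ ψ : Chain W (o X) (o Y) → M) (p : Chain V X Y) :
    bs F (fun q => φ q + ψ q) p = bs F φ p + bs F ψ p := sumBlocks_add _ _ _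

lemma bs_zero {X Y : Ob} (p : Chain V X Y) : bs F (fun _ => (0 : M)) p = 0 := sumBlocks_zero _

lemma bs_smul {K : Type u} [Field K] {M : Type u} [AddCommGroup M] [Module K M] {X Y : Ob}
    (r : K) (φ : Chain W (o X) (o Y) → M) (p : Chain V X Y) :
    bs F (fun q => r • φ q) p = r • bs F φ p := sumBlocks_smul _ _ _

/-- `bs F` as an additive map in `φ`. -/
def bsHom {X Y : Ob} (p : Chain V X Y) : (Chain W (o X) (o Y) → M) →+ M where
  toFun φ := bs F φ p
  map_zero' := bs_zero F p
  map_add' φ ψ := bs_add F φ ψ p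

lemma bs_sumSplit' {X Y X' Y' : Ob} (p : Chain V X Y) (r : Chain V X' Y')
    (φ : ∀ Z : Ob, Chain V X' Z → Chain V Z Y' → Chain W (o X) (o Y) → M) :
    bs F (fun q => sumSplit r (fun Z a b => φ Z a b q)) p =
      sumSplit r (fun Z a b => bs F (φ Z a b) p) := by
  have := map_sumSplit (bsHom (M := M) F p) r φ
  simp only [bsHom, AddMonoidHom.coe_mk, ZeroHom.coe_mk] at this
  rw [← this]
  congr 1
  funext q
  exact (map_sumSplit (Pi.evalAddMonoidHom (fun _ : Chain W (o X) (o Y) => M) q) r φ).symm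

/-- Cutting chains is compatible with block decompositions. -/
lemma bs_sumSplit {X Y : Ob} (p : Chain V X Y)
    (Ψ : ∀ Z : Ob', Chain W (o X) Z → Chain W Z (o Y) → M) :
    bs F (fun q => sumSplit q Ψ) p =
      sumSplit p (fun Z a b => bs F (fun q₁ => bs F (fun q₂ => Ψ (o Z) q₁ q₂) b) a) := by
  induction hn : p.length using Nat.strong_induction_on generalizing Y with
  | _ n ih =>
  cases p with
  | nil => rfl
  | cons p f =>
    rw [bs_cons]
    simp only [sumSplit, bs_add, sumSplit_add]
    rw [← bs_cons (F := F) (φ := fun q => Ψ _ q (nil _))]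
    congr 1
    rw [sumSplit_congr p (ψ := fun Z a c => sumSplit a (fun Z' a₁ a₂ =>
      bs F (fun q₁ => bs F (fun q₂ => Ψ (o Z') q₁ (q₂.cons (F (c.cons f)))) a₂) a₁))]
    · rw [sumSplit_assoc p (fun Z W a b c => bs F (fun q₁ => bs F (fun q₂ =>
        Ψ (o Z) q₁ (q₂.cons (F (c.cons f)))) b) a)]
      refine sumSplit_congr _ fun Z a d _ => ?_
      rw [← bs_sumSplit']
      simp only [bs_cons]
    · intro Z a c hac
      refine ih a.length ?_ a (fun T q₁ q₂ => Ψ T q₁ (q₂.cons (F (c.cons f)))) rfl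
      rw [← hn, length_cons, ← hac, length_append]; omega

end blockSum

end Chain

namespace Chain

variable {Ob : Type u} {V : Ob → Ob → Type u} {Ob' : Type u} {W : Ob' → Ob' → Type u}
  {Ob'' : Type u} {U : Ob'' → Ob'' → Type u} {o : Ob → Ob'} {o' : Ob' → Ob''}

section linear

variable {K : Type u} [Field K] [∀ X Y, AddCommGroup (V X Y)] [∀ X Y, Module K (V X Y)]
  [∀ X Y, AddCommGroup (W X Y)] [∀ X Y, Module K (W X Y)]
  [∀ X Y, AddCommGroup (U X Y)] [∀ X Y, Module K (U X Y)]
  {M : Type u} [AddCommGroup M] [Module K M]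

lemma isLinearMap_sumSplit {N : Type u} [AddCommGroup N] [Module K N] {X Y : Ob} (p : Chain V X Y)
    (φ : N → ∀ Z : Ob, Chain V X Z → Chain V Z Y → M)
    (h : ∀ Z a b, IsLinearMap K (fun x => φ x Z a b)) :
    IsLinearMap K (fun x => sumSplit p (φ x)) := by
  induction p with
  | nil => exact h _ _ _
  | cons p f ih =>
    have h1 := h _ (p.cons f) (nil _)
    have h2 := ih (fun x W a b => φ x W a (b.cons f)) (fun _ _ _ => h _ _ _)
    constructor
    · intro x y
      simp only [sumSplit, h1.map_add, h2.map_add]; abel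
    · intro r x
      simp only [sumSplit, h1.map_smul, h2.map_smul, smul_add]

lemma isLinearMap_bs {N : Type u} [AddCommGroup N] [Module K N]
    (F : ∀ {X Y : Ob}, Chain V X Y → W (o X) (o Y)) {X Y : Ob} (p : Chain V X Y)
    (φ : N → Chain W (o X) (o Y) → M) (h : ∀ q, IsLinearMap K (fun x => φ x q)) :
    IsLinearMap K (fun x => bs F (φ x) p) := by
  constructor
  · intro x y
    rw [← bs_add]
    congr 1
    funext q
    exact (h q).map_add x y
  · intro r x
    rw [← bs_smul]
    congr 1
    funext q
    exact (h q).map_smul r x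

lemma Multilinear.last {X Y Z : Ob} {φ : Chain V X Z → M} (h : Multilinear K φ)
    (q : Chain V X Y) : IsLinearMap K (fun x : V Y Z => φ (q.cons x)) := h _ _ q (nil _)

lemma Multilinear.init {X Y Z : Ob} {φ : Chain V X Z → M} (h : Multilinear K φ) (x : V Y Z) :
    Multilinear K (fun q => φ (q.cons x)) := fun _ _ a c => h _ _ a (c.cons x)

lemma Multilinear.tail {X Y Z : Ob} {φ : Chain V X Z → M} (h : Multilinear K φ)
    (p : Chain V X Y) : Multilinear K (fun q => φ (p.append q)) := by
  intro S T a c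
  have := h _ _ (p.append a) c
  simpa [← append_assoc] using this

lemma isLinearMap_comp {N₁ N₂ N₃ : Type u} [AddCommGroup N₁] [Module K N₁] [AddCommGroup N₂]
    [Module K N₂] [AddCommGroup N₃] [Module K N₃] {f : N₂ → N₃} {g : N₁ → N₂}
    (hf : IsLinearMap K f) (hg : IsLinearMap K g) : IsLinearMap K (fun x => f (g x)) :=
  ⟨fun x y => by rw [hg.map_add, hf.map_add], fun r x => by rw [hg.map_smul, hf.map_smul]⟩

lemma isLinearMap_sum {N₁ N₂ : Type u} [AddCommGroup N₁] [Module K N₁] [AddCommGroup N₂]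
    [Module K N₂] {f g : N₁ → N₂}
    (hf : IsLinearMap K f) (hg : IsLinearMap K g) : IsLinearMap K (fun x => f x + g x) :=
  ⟨fun x y => by rw [hg.map_add, hf.map_add]; abel,
   fun r x => by rw [hg.map_smul, hf.map_smul, smul_add]⟩

lemma Multilinear.bs {F : ∀ {X Y : Ob}, Chain V X Y → W (o X) (o Y)}
    (hF : ∀ X Y, Multilinear K (fun p : Chain V X Y => F p)) {X Y : Ob}
    {φ : Chain W (o X) (o Y) → M} (hφ : Multilinear K φ) :
    Multilinear K (fun p : Chain V X Y => bs F φ p) := by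
  intro S T a c
  induction hn : c.length using Nat.strong_induction_on generalizing Y with
  | _ n ih =>
  cases c with
  | nil =>
    simp only [append_nil, bs_cons]
    refine isLinearMap_sumSplit _ _ fun Z a' c' => ?_
    refine isLinearMap_bs _ _ _ fun q => ?_
    exact isLinearMap_comp (f := fun x => φ (q.cons x)) (hφ.last q) ((hF _ _).last c')
  | cons c f =>
    simp only [append_cons, bs_cons, sumSplit_append_cons]
    refine isLinearMap_sum ?_ ?_
    · have : ∀ x : V S T, (c.sumSplit fun T_1 c₁ c₂ =>
          Chain.bs F (fun q => φ (q.cons (F (c₂.cons f)))) ((a.cons x).append c₁)) =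
          c.sumSplit fun T_1 c₁ c₂ => if c₁.length < n then
          Chain.bs F (fun q => φ (q.cons (F (c₂.cons f)))) ((a.cons x).append c₁) else 0 := by
        intro x
        refine sumSplit_congr _ fun Z c₁ c₂ h => ?_
        rw [if_pos]
        rw [← hn, length_cons, ← h, length_append]; omega
      simp only [this]
      refine isLinearMap_sumSplit _ _ fun Z c₁ c₂ => ?_
      split_ifs with hlt
      · exact ih _ hlt (hφ.init _) c₁ rfl
      · exact ⟨fun _ _ => by simp, fun _ _ => by simp⟩
    · refine isLinearMap_sumSplit _ _ fun Z a₁ a₂ => ?_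
      refine isLinearMap_bs _ _ _ fun q => ?_
      exact isLinearMap_comp (f := fun x => φ (q.cons x)) (hφ.last q) (hF _ _ _ _ a₂ (c.cons f))

lemma isLinearMap.sumSplit {N : Type u} [AddCommGroup N] [Module K N]
    {f : N → M} (hf : IsLinearMap K f) {X Y : Ob} (p : Chain V X Y)
    (φ : ∀ Z : Ob, Chain V X Z → Chain V Z Y → N) :
    f (Chain.sumSplit p φ) = Chain.sumSplit p (fun Z a b => f (φ Z a b)) :=
  map_sumSplit (hf.mk' f).toAddMonoidHom p φ

lemma isLinearMap.bs {N : Type u} [AddCommGroup N] [Module K N]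
    {f : N → M} (hf : IsLinearMap K f) (F : ∀ {X Y : Ob}, Chain V X Y → W (o X) (o Y))
    {X Y : Ob} (p : Chain V X Y) (φ : Chain W (o X) (o Y) → N) :
    f (Chain.bs F φ p) = Chain.bs F (fun q => f (φ q)) p := by
  induction hn : p.length using Nat.strong_induction_on generalizing Y with
  | _ n ih =>
  cases p with
  | nil => rfl
  | cons p g =>
    rw [bs_cons, bs_cons, isLinearMap.sumSplit hf]
    refine sumSplit_congr _ fun Z a c h => ?_
    refine ih _ ?_ a _ rfl
    rw [← hn, length_cons, ← h, length_append]; omega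

/-- Associativity of the composition given by sums over block decompositions. -/
lemma bs_bs {F : ∀ {X Y : Ob}, Chain V X Y → W (o X) (o Y)}
    {G : ∀ {X Y : Ob'}, Chain W X Y → U (o' X) (o' Y)} {X Y : Ob}
    {φ : Chain U (o' (o X)) (o' (o Y)) → M} (hφ : Multilinear K φ) (p : Chain V X Y) :
    bs (o := fun X => o' (o X)) (fun p => bs F (fun q => G q) p) φ p =
      bs F (fun q => bs G φ q) p := by
  induction hn : p.length using Nat.strong_induction_on generalizing Y with
  | _ n ih =>
  cases p with
  | nil => rfl
  | cons p f =>
    rw [bs_cons, bs_cons]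
    have : ∀ (Z : Ob) (a : Chain V X Z) (x : W (o Z) (o Y)),
        bs F (fun q => bs G φ (q.cons x)) a = sumSplit a (fun T a₁ a₂ => bs F (fun q₁ =>
          bs F (fun q₂ => bs G (fun r => φ (r.cons (G (q₂.cons x)))) q₁) a₂) a₁) := by
      intro Z a x
      simp only [bs_cons G]
      rw [bs_sumSplit F a (fun T q₁ q₂ => bs G (fun r => φ (r.cons (G (q₂.cons x)))) q₁)]
    simp only [this]
    rw [sumSplit_assoc p (fun S T a b c => bs F (fun q₁ => bs F (fun q₂ =>
      bs G (fun r => φ (r.cons (G (q₂.cons (F (c.cons f)))))) q₁) b) a)]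
    simp only [← bs_sumSplit' F]
    refine sumSplit_congr _ fun Z a c h => ?_
    rw [ih a.length _ (hφ.init _) a rfl]
    · congr 1
      funext q
      exact (isLinearMap.bs (isLinearMap_bs G q (fun x q' => φ (q'.cons x))
        (fun q' => hφ.last q')) F (c.cons f) (fun q => G q)).trans (bs_cons F _ c f)
    · rw [← hn, length_cons, ← h, length_append]; omega

/-- The coderivation sum, without signs except those coming from the involution `σ`. -/
def cod (σ : ∀ {X Y : Ob}, V X Y → V X Y) (B : ∀ {X Y : Ob}, Chain V X Y → V X Y)
    {X Y : Ob} (φ : Chain V X Y → M) (p : Chain V X Y) : M :=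
  sumSplit p fun _ a bc => sumSplit bc fun _ b c => φ ((a.cons (B b)).append (c.map σ))

lemma cod_cons {σ : ∀ {X Y : Ob}, V X Y → V X Y} {B : ∀ {X Y : Ob}, Chain V X Y → V X Y}
    (hB : ∀ X, B (nil X : Chain V X X) = 0) {X Y Z : Ob} {φ : Chain V X Z → M}
    (hφ : Multilinear K φ) (p : Chain V X Y) (f : V Y Z) :
    cod σ B φ (p.cons f) = cod σ B (fun q => φ (q.cons (σ f))) p +
      sumSplit p (fun _ a b => φ (a.cons (B (b.cons f)))) := by
  have h0 : ∀ (T : Ob) (a : Chain V X T) (T' : Ob) (c : Chain V T' Z),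
      φ ((a.cons (0 : V T T')).append c) = 0 := fun T a T' c => (hφ T T' a c).map_zero
  have h0' : ∀ a : Chain V X Z, φ (a.cons (0 : V Z Z)) = 0 := fun a => (hφ.last a).map_zero
  simp only [cod, sumSplit, map, append_nil, hB, append_cons, sumSplit_add, h0', zero_add]
  rw [add_comm]

lemma sumSplit_comm {X Y X' Y' : Ob} (p : Chain V X Y) (r : Chain V X' Y')
    (φ : ∀ Z : Ob, Chain V X Z → Chain V Z Y → ∀ T : Ob, Chain V X' T → Chain V T Y' → M) :
    sumSplit p (fun Z a b => sumSplit r (φ Z a b)) =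
      sumSplit r (fun T c d => sumSplit p (fun Z a b => φ Z a b T c d)) := by
  induction p with
  | nil => rfl
  | cons p f ih => simp only [sumSplit, ih, sumSplit_add]

lemma cod_sumSplit (σ : ∀ {X Y : Ob}, V X Y → V X Y) (B : ∀ {X Y : Ob}, Chain V X Y → V X Y)
    {X Y : Ob} (p : Chain V X Y) (Ψ : ∀ Z : Ob, Chain V X Z → Chain V Z Y → M) :
    cod σ B (fun q => sumSplit q Ψ) p =
      sumSplit p (fun Z a c => cod σ B (fun q => Ψ Z q (c.map σ)) a) +
      sumSplit p (fun Z a c => cod σ B (fun q => Ψ Z a q) c) := by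
  simp only [cod, sumSplit_append_cons, sumSplit_add, sumSplit_map]
  congr 1
  · rw [sumSplit_assoc p (fun S T a b c => sumSplit b fun _ b₁ b₂ =>
      Ψ T ((a.cons (B b₁)).append (b₂.map σ)) (c.map σ))]
    refine sumSplit_congr _ fun Z a d _ => ?_
    rw [sumSplit_assoc d (fun S T b c₁ c₂ => Ψ T ((a.cons (B b)).append (c₁.map σ)) (c₂.map σ))]
  · rw [← sumSplit_assoc p (fun S T a b c => sumSplit c fun _ c₁ c₂ =>
      Ψ S a ((b.cons (B c₁)).append (c₂.map σ)))]
    refine sumSplit_congr _ fun Z a d _ => ?_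
    rw [sumSplit_comm]

/-- The extension of `F` to chains intertwines the coderivations if `F` satisfies the
relations of a functor. -/
lemma bs_cod {σ : ∀ {X Y : Ob}, V X Y → V X Y} {B : ∀ {X Y : Ob}, Chain V X Y → V X Y}
    {σ' : ∀ {X Y : Ob'}, W X Y → W X Y} {B' : ∀ {X Y : Ob'}, Chain W X Y → W X Y}
    {F : ∀ {X Y : Ob}, Chain V X Y → W (o X) (o Y)}
    (hB : ∀ X, B (nil X : Chain V X X) = 0) (hB' : ∀ X, B' (nil X : Chain W X X) = 0)
    (hF : ∀ X Y, Multilinear K (fun p : Chain V X Y => F p))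
    (hσ : ∀ (X Y : Ob) (p : Chain V X Y), F (p.map σ) = σ' (F p))
    (hrel : ∀ (X Y : Ob) (p : Chain V X Y), cod σ B (fun q => F q) p = bs F (fun q => B' q) p)
    {X Y : Ob} {φ : Chain W (o X) (o Y) → M} (hφ : Multilinear K φ) (p : Chain V X Y) :
    bs F (fun q => cod σ' B' φ q) p = cod σ B (fun q => bs F φ q) p := by
  induction hn : p.length using Nat.strong_induction_on generalizing Y with
  | _ n ih =>
  cases p with
  | nil =>
    rw [bs_nil, cod, cod]
    simp only [sumSplit, map, append_nil, hB', bs_cons, bs_nil]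
    rw [(hφ.last _).map_zero]
    rw [hB, ((hF _ _).last _).map_zero, (hφ.last _).map_zero]
  | cons p f =>
    -- left hand side
    rw [bs_cons]
    simp only [cod_cons hB' hφ, bs_add, sumSplit_add]
    have e1 : (p.sumSplit fun T a c => bs F (fun q => cod σ' B'
          (fun q' => φ (q'.cons (σ' (F (c.cons f))))) q) a) =
        p.sumSplit fun T a c => cod σ B (fun q => bs F (fun q' =>
          φ (q'.cons (F ((c.map σ).cons (σ f))))) q) a := by
      refine sumSplit_congr _ fun Z a c h => ?_
      rw [ih a.length _ (hφ.init _) a rfl]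
      · rw [← hσ]; rfl
      · rw [← hn, length_cons, ← h, length_append]; omega
    have e2 : (p.sumSplit fun T a c => bs F (fun q => sumSplit q fun S a' b' =>
          φ (a'.cons (B' (b'.cons (F (c.cons f)))))) a) =
        p.sumSplit fun T a c => bs F (fun q => φ (q.cons (cod σ B (fun r => F r) (c.cons f)))) a := by
      have : ∀ (Z : Ob) (a : Chain V X Z) (x : W (o Z) (o Y)),
          bs F (fun q => sumSplit q fun S a' b' => φ (a'.cons (B' (b'.cons x)))) a =
          sumSplit a (fun T a₁ a₂ => bs F (fun q₁ =>
            bs F (fun q₂ => φ (q₁.cons (B' (q₂.cons x)))) a₂) a₁) := by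
        intro Z a x
        rw [bs_sumSplit F a (fun T q₁ q₂ => φ (q₁.cons (B' (q₂.cons x))))]
      simp only [this]
      rw [sumSplit_assoc p (fun S T a b c => bs F (fun q₁ => bs F (fun q₂ =>
        φ (q₁.cons (B' (q₂.cons (F (c.cons f)))))) b) a)]
      simp only [← bs_sumSplit' F]
      refine sumSplit_congr _ fun Z a c h => ?_
      congr 1
      funext q
      rw [hrel, isLinearMap.bs (hφ.last q) F, bs_cons]
    rw [e1, e2]
    -- right hand side
    have hb := Multilinear.bs hF hφ
    rw [cod_cons hB hb]
    simp only [bs_cons]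
    rw [cod_sumSplit σ B p (fun T a' c' => bs F (fun q => φ (q.cons (F (c'.cons (σ f))))) a'),
      add_assoc]
    congr 1
    rw [sumSplit_assoc p (fun S T a b c => bs F (fun q => φ (q.cons
      (F (b.cons (B (c.cons f)))))) a), ← sumSplit_add]
    refine sumSplit_congr _ fun Z a c _ => ?_
    rw [cod_cons hB (hF _ _), cod, cod]
    have hl := isLinearMap_bs (K := K) F a (fun x q => φ (q.cons x)) (fun q => hφ.last q)
    rw [hl.map_add, isLinearMap.sumSplit hl, isLinearMap.sumSplit hl]
    simp only [isLinearMap.sumSplit hl]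

end linear

end Chain

/-- A `ℤ`-graded `K`-linear quiver: a set of objects and, for any two objects, a `ℤ`-graded
`K`-vector space (a vector space which is the direct sum of its homogeneous components). -/
structure GradedQuiver (K : Type u) [Field K] where
  Ob : Type u
  Hom : Ob → Ob → Type u
  [addCommGroup : ∀ X Y, AddCommGroup (Hom X Y)]
  [module : ∀ X Y, Module K (Hom X Y)]
  /-- the homogeneous component of a given degree -/
  gr : ∀ X Y, ℤ → Submodule K (Hom X Y)
  internal : ∀ X Y, DirectSum.IsInternal (gr X Y)

attribute [instance] GradedQuiver.addCommGroup GradedQuiver.module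

/-- The sign `(-1)ⁿ` as an element of `K`. -/
def sgn (K : Type u) [Field K] (n : ℤ) : K := ((n.negOnePow : ℤˣ) : ℤ)

namespace GradedQuiver

variable {K : Type u} [Field K] (Q : GradedQuiver K)

/-- The linear map `x ↦ (-1)^{k|x|} x` (for homogeneous `x`). -/
noncomputable def twist (k : ℤ) {X Y : Q.Ob} : Q.Hom X Y →ₗ[K] Q.Hom X Y :=
  (DirectSum.toModule K ℤ (Q.Hom X Y) fun d => sgn K (k * d) • (Q.gr X Y d).subtype) ∘ₗ
    (LinearEquiv.ofBijective (DirectSum.coeLinearMap (Q.gr X Y)) (Q.internal X Y)).symm.toLinearMap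

/-- `twist` applied to every arrow of a chain: for homogeneous arrows this multiplies
`fₙ ⊗ ⋯ ⊗ f₁` by the Koszul sign of an operation of degree `k` moving past it. -/
noncomputable def twistChain (k : ℤ) {X Y : Q.Ob} (p : Chain Q.Hom X Y) : Chain Q.Hom X Y :=
  p.map fun f => Q.twist k f

/-- All the arrows of the chain are homogeneous, and their degrees add up to `d`. -/
def HasDegree {X Y : Q.Ob} : Chain Q.Hom X Y → ℤ → Prop
  | .nil _, d => d = 0
  | .cons p f, d => ∃ e e' : ℤ, HasDegree p e ∧ f ∈ Q.gr _ _ e' ∧ d = e + e'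

/-- The sum of `(-1)^{jk+l} φ ∘ (id^{⊗ j} ⊗ m_k ⊗ id^{⊗ l})`, with `j + k + l = n`, evaluated at the
chain `p = (fₙ, …, f₁)`. Here `p` is cut as `fₙ ⊗ ⋯ ⊗ f₁ = c ⊗ b ⊗ a` with `c`, `b`, `a` of lengths
`j`, `k`, `l`, and the Koszul sign comes from `m_k`, of degree `2 - k`, moving past `c`. (The terms
with `k = 0` vanish, as `m` is always `0` on chains of length `0`.) -/
noncomputable def coderSum (m : ∀ {X Y : Q.Ob}, Chain Q.Hom X Y → Q.Hom X Y)
    {M : Type u} [AddCommGroup M] [Module K M] {X Y : Q.Ob} (φ : Chain Q.Hom X Y → M)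
    (p : Chain Q.Hom X Y) : M :=
  p.sumSplit fun _ a bc => bc.sumSplit fun _ b c =>
    sgn K (c.length * b.length + a.length) •
      φ ((a.cons (m b)).append (Q.twistChain (2 - b.length) c))

/-- For a decomposition into blocks of lengths `s_r, …, s_1`, the degree `∑ᵤ (1 - sᵤ)` of
`F^{s_r} ⊗ ⋯ ⊗ F^{s_1}`. -/
def blockShift {Ob : Type u} {V : Ob → Ob → Type u} {X Y : Ob} : Chain (Chain V) X Y → ℤ
  | .nil _ => 0
  | .cons D b => blockShift D + (1 - b.length)

/-- For a decomposition into blocks of lengths `s_r, …, s_1` (from left to right), the exponent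
`∑ᵤ (1 - sᵤ) ∑_{v > u} sᵥ`. -/
def blockSign {Ob : Type u} {V : Ob → Ob → Type u} {X Y : Ob} : Chain (Chain V) X Y → ℤ
  | .nil _ => 0
  | .cons D b => blockSign D + blockShift D * b.length

variable {Q} {R : GradedQuiver K} {o : Q.Ob → R.Ob}

/-- `(F^{s_r} ⊗ ⋯ ⊗ F^{s_1}) (b_r ⊗ ⋯ ⊗ b_1)`, where `F` is of degree `1 - s` on chains of length `s`,
including the Koszul signs. -/
noncomputable def blockMap (F : ∀ {X Y : Q.Ob}, Chain Q.Hom X Y → R.Hom (o X) (o Y))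
    {X Y : Q.Ob} : Chain (Chain Q.Hom) X Y → Chain R.Hom (o X) (o Y)
  | .nil _ => .nil _
  | .cons D b => (blockMap F D).cons (F (Q.twistChain (blockShift D) b))

/-- The sum of `(-1)^{∑ᵤ (1 - sᵤ) ∑_{v > u} sᵥ} φ ∘ (F^{s_r} ⊗ ⋯ ⊗ F^{s_1})` over
`s_1 + ⋯ + s_r = n` with all `sᵤ ≥ 1`, evaluated at the chain `p` of length `n`. -/
noncomputable def blockSum (F : ∀ {X Y : Q.Ob}, Chain Q.Hom X Y → R.Hom (o X) (o Y))
    {M : Type u} [AddCommGroup M] [Module K M] {X Y : Q.Ob} (φ : Chain R.Hom (o X) (o Y) → M)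
    (p : Chain Q.Hom X Y) : M :=
  p.sumBlocks fun D => sgn K (blockSign D) • φ (blockMap F D)

/-! ### Signs -/

end GradedQuiver

section sgn
variable (K : Type u) [Field K]

lemma sgn_add (a b : ℤ) : sgn K (a + b) = sgn K a * sgn K b := by
  simp [sgn, Int.negOnePow_add]

lemma sgn_congr {a b : ℤ} (h : (a : ZMod 2) = b) : sgn K a = sgn K b := by
  have h2 : Even (a - b) := by
    rw [ZMod.intCast_eq_intCast_iff_dvd_sub] at h
    obtain ⟨c, hc⟩ := h
    exact ⟨-c, by push_cast at hc; omega⟩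
  rw [show a = b + (a - b) by ring, sgn_add]
  simp [sgn, Int.negOnePow_even _ h2]

lemma sgn_zero : sgn K 0 = 1 := by simp [sgn]

lemma sgn_mul_self (a : ℤ) : sgn K a * sgn K a = 1 := by
  rw [← sgn_add, ← sgn_zero K]
  apply sgn_congr
  push_cast
  generalize (a : ZMod 2) = x
  revert x; decide

end sgn

/-- Triangular numbers. -/
def tri : ℕ → ℤ
  | 0 => 0
  | n + 1 => tri n + n

lemma tri_add (a b : ℕ) : tri (a + b) = tri a + tri b + a * b := by
  induction b with
  | zero => simp [tri]
  | succ b ih => rw [← add_assoc, tri, ih, tri]; push_cast; ring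

namespace Chain

variable {Ob : Type u} {V : Ob → Ob → Type u}

@[simp] lemma length_map (g : ∀ {X Y : Ob}, V X Y → V X Y) {X Y : Ob} (p : Chain V X Y) :
    (p.map g).length = p.length := by
  induction p with
  | nil => rfl
  | cons p f ih => simp [map, ih]

lemma map_append (g : ∀ {X Y : Ob}, V X Y → V X Y) {X Y Z : Ob} (p : Chain V X Y)
    (q : Chain V Y Z) : (p.append q).map g = (p.map g).append (q.map g) := by
  induction q with
  | nil => rfl
  | cons q f ih => simp [map, ih]

lemma map_map (g h : ∀ {X Y : Ob}, V X Y → V X Y) {X Y : Ob} (p : Chain V X Y) :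
    (p.map g).map h = p.map (fun x => h (g x)) := by
  induction p with
  | nil => rfl
  | cons p f ih => simp [map, ih]

variable {K : Type u} [Field K] [∀ X Y, AddCommGroup (V X Y)] [∀ X Y, Module K (V X Y)]
  {M : Type u} [AddCommGroup M] [Module K M]

lemma Multilinear.map {X Y : Ob} {φ : Chain V X Y → M} (h : Multilinear K φ)
    (g : ∀ {X Y : Ob}, V X Y → V X Y) (hg : ∀ X Y, IsLinearMap K (g : V X Y → V X Y)) :
    Multilinear K (fun p => φ (p.map g)) := by
  intro S T a c
  simp only [map_append, Chain.map]
  exact isLinearMap_comp (f := fun x => φ (((a.map g).cons x).append (c.map g))) (h _ _ _ _)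
    (hg S T)

lemma Multilinear.map_smul {X Y : Ob} {φ : Chain V X Y → M} (h : Multilinear K φ)
    (g : ∀ {X Y : Ob}, V X Y → V X Y) (r : K) (p : Chain V X Y) :
    φ (p.map (fun x => r • g x)) = r ^ p.length • φ (p.map g) := by
  induction p with
  | nil => simp [Chain.map]
  | cons p f ih =>
    simp only [Chain.map]
    rw [(h.last _).map_smul, ih (h.init (g f)), length_cons, pow_succ, smul_smul, mul_comm]

end Chain

namespace GradedQuiver

variable {K : Type u} [Field K] (Q : GradedQuiver K)

lemma twist_of_mem (k : ℤ) {X Y : Q.Ob} {d : ℤ} {x : Q.Hom X Y} (hx : x ∈ Q.gr X Y d) :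
    Q.twist k x = sgn K (k * d) • x := by
  have : (LinearEquiv.ofBijective (DirectSum.coeLinearMap (Q.gr X Y)) (Q.internal X Y)).symm x =
      DirectSum.lof K ℤ (fun d => Q.gr X Y d) d ⟨x, hx⟩ := by
    rw [LinearEquiv.symm_apply_eq]
    exact (DirectSum.coeLinearMap_lof (Q.gr X Y) d ⟨x, hx⟩).symm
  simp only [twist, LinearMap.comp_apply, LinearEquiv.coe_coe, this, DirectSum.toModule_lof]
  rfl

lemma linear_ext {M : Type u} [AddCommGroup M] [Module K M] {X Y : Q.Ob} {f g : Q.Hom X Y → M}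
    (hf : IsLinearMap K f) (hg : IsLinearMap K g) (h : ∀ d, ∀ x ∈ Q.gr X Y d, f x = g x)
    (x : Q.Hom X Y) : f x = g x := by
  have hx : x ∈ iSup (Q.gr X Y) := by
    rw [(Q.internal X Y).submodule_iSup_eq_top]; trivial
  induction hx using Submodule.iSup_induction' with
  | mem i x hx => exact h i x hx
  | zero => rw [hf.map_zero, hg.map_zero]
  | add x y _ _ hx hy => rw [hf.map_add, hg.map_add, hx, hy]

lemma twist_congr {k l : ℤ} (h : (k : ZMod 2) = l) {X Y : Q.Ob} (x : Q.Hom X Y) :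
    Q.twist k x = Q.twist l x := by
  refine Q.linear_ext (LinearMap.isLinear _) (LinearMap.isLinear _) (fun d x hx => ?_) x
  rw [Q.twist_of_mem k hx, Q.twist_of_mem l hx]
  congr 1
  exact sgn_congr K (by push_cast; rw [h])

lemma twist_zero {X Y : Q.Ob} (x : Q.Hom X Y) : Q.twist 0 x = x := by
  refine Q.linear_ext (f := fun x => Q.twist 0 x) (g := fun x => x) (LinearMap.isLinear _)
    LinearMap.id.isLinear (fun d x hx => ?_) x
  simp only [Q.twist_of_mem 0 hx, zero_mul, sgn_zero, one_smul]

lemma twist_twist (k l : ℤ) {X Y : Q.Ob} (x : Q.Hom X Y) :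
    Q.twist k (Q.twist l x) = Q.twist (k + l) x := by
  refine Q.linear_ext (f := fun x => Q.twist k (Q.twist l x))
    (Q.twist k ∘ₗ Q.twist l).isLinear (LinearMap.isLinear _) (fun d x hx => ?_) x
  simp only [Q.twist_of_mem l hx, LinearMap.map_smul, Q.twist_of_mem k hx,
    Q.twist_of_mem (k + l) hx, smul_smul, ← sgn_add]
  congr 2; ring

lemma twist_double (k : ℤ) {X Y : Q.Ob} (x : Q.Hom X Y) : Q.twist (k + k) x = x := by
  rw [Q.twist_congr (l := 0), twist_zero]
  push_cast
  generalize (k : ZMod 2) = x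
  revert x; decide

/-- Multilinear functions are determined by their values on chains of homogeneous arrows. -/
lemma multilinear_ext {M : Type u} [AddCommGroup M] [Module K M] {X Y : Q.Ob}
    {φ ψ : Chain Q.Hom X Y → M} (hφ : Chain.Multilinear K φ) (hψ : Chain.Multilinear K ψ)
    (h : ∀ p d, Q.HasDegree p d → φ p = ψ p) (p : Chain Q.Hom X Y) : φ p = ψ p := by
  induction p with
  | nil => exact h _ 0 rfl
  | cons p f ih =>
    refine ih (hφ.init f) (hψ.init f) fun q d hq => ?_
    refine Q.linear_ext (hφ.last q) (hψ.last q) (fun e x hx => ?_) f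
    exact h _ _ ⟨d, e, hq, hx, rfl⟩

lemma twistChain_of_hasDegree {M : Type u} [AddCommGroup M] [Module K M] {X Y : Q.Ob}
    {φ : Chain Q.Hom X Y → M} (hφ : Chain.Multilinear K φ) (k : ℤ) (p : Chain Q.Hom X Y) (d : ℤ)
    (hp : Q.HasDegree p d) : φ (Q.twistChain k p) = sgn K (k * d) • φ p := by
  induction p generalizing d with
  | nil => obtain rfl : d = 0 := hp; simp [twistChain, Chain.map, sgn_zero]
  | cons p f ih =>
    obtain ⟨e, e', h1, h2, rfl⟩ := hp
    change φ ((Q.twistChain k p).cons (Q.twist k f)) = _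
    rw [Q.twist_of_mem k h2, (hφ.last _).map_smul, ih (hφ.init f) e h1, smul_smul, ← sgn_add]
    congr 2; ring

lemma isLinearMap_smul (r : K) {N M : Type u} [AddCommGroup M] [Module K M] [AddCommGroup N]
    [Module K N] {f : N → M} (h : IsLinearMap K f) : IsLinearMap K (fun x => r • f x) :=
  ⟨fun x y => by rw [h.map_add, smul_add], fun s x => by rw [h.map_smul, smul_comm]⟩

variable {R : GradedQuiver K} {o : Q.Ob → R.Ob}

/-- `F` is of degree `c - n` on chains of length `n`. -/
def IsDeg (o : Q.Ob → R.Ob) (c : ℤ) (F : ∀ {X Y : Q.Ob}, Chain Q.Hom X Y → R.Hom (o X) (o Y)) :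
    Prop :=
  ∀ (X Y : Q.Ob) (p : Chain Q.Hom X Y) (d : ℤ), Q.HasDegree p d →
    F p ∈ R.gr _ _ (d + c - p.length)

/-- `F` is multilinear. -/
def IsMulti (o : Q.Ob → R.Ob) (F : ∀ {X Y : Q.Ob}, Chain Q.Hom X Y → R.Hom (o X) (o Y)) :
    Prop :=
  ∀ X Y : Q.Ob, Chain.Multilinear K (fun p : Chain Q.Hom X Y => F p)

variable {Q}

lemma twist_apply {c : ℤ} {F : ∀ {X Y : Q.Ob}, Chain Q.Hom X Y → R.Hom (o X) (o Y)}
    (hF : Q.IsMulti o F) (hd : Q.IsDeg o c F) (k : ℤ) {X Y : Q.Ob}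
    (p : Chain Q.Hom X Y) :
    F (Q.twistChain k p) = sgn K (k * (c - p.length)) • R.twist k (F p) := by
  -- reduce to homogeneous chains, keeping track of the length
  have key : ∀ (n : ℕ) {Z : Q.Ob} (q : Chain Q.Hom X Z) (φ ψ : Chain Q.Hom X Z → R.Hom (o X) (o Y)),
      Chain.Multilinear K φ → Chain.Multilinear K ψ →
      (∀ q' d, Q.HasDegree q' d → q'.length = n → φ q' = ψ q') → q.length = n → φ q = ψ q := by
    intro n Z q φ ψ hφ hψ h hq
    induction q generalizing n with
    | nil => exact h _ 0 rfl hq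
    | cons q f ih =>
      subst hq
      refine ih q.length (fun q => φ (q.cons f)) (fun q => ψ (q.cons f)) (hφ.init f) (hψ.init f)
        (fun q' d hq' hl => ?_) rfl
      refine Q.linear_ext (hφ.last q') (hψ.last q') (fun e x hx => ?_) f
      exact h _ _ ⟨d, e, hq', hx, rfl⟩ (by simp [hl])
  refine key p.length p (fun p => F (Q.twistChain k p))
    (fun q => sgn K (k * (c - p.length)) • R.twist k (F q)) ?_ ?_ ?_ rfl
  · exact (hF X Y).map _ fun _ _ => LinearMap.isLinear _
  · intro S T a c
    exact isLinearMap_smul _ (Chain.isLinearMap_comp (LinearMap.isLinear (R.twist k)) (hF _ _ _ _ a c))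
  · intro q d hq hl
    rw [Q.twistChain_of_hasDegree (φ := fun p => F p) (hF X Y) k q d hq, R.twist_of_mem k (hd _ _ _ _ hq), smul_smul,
      ← sgn_add, hl]
    congr 1
    apply sgn_congr
    push_cast
    generalize (k : ZMod 2) = k
    generalize (d : ZMod 2) = d
    generalize (c : ZMod 2) = c
    generalize (p.length : ZMod 2) = l
    revert k d c l; decide

end GradedQuiver

namespace GradedQuiver

variable {K : Type u} [Field K] {Q R : GradedQuiver K} {o : Q.Ob → R.Ob}
  {M : Type u} [AddCommGroup M] [Module K M]

/-- Apply `twist (i - 1)` to the `i`-th arrow `fᵢ` of a chain `(fₙ, …, f₁)`. -/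
noncomputable def ramp {X Y : Q.Ob} : Chain Q.Hom X Y → Chain Q.Hom X Y
  | .nil _ => .nil _
  | .cons p f => (ramp p).cons (Q.twist p.length f)

/-- Passage between functions of chains and functions of chains of shifted arrows. -/
noncomputable def hat {X Y : Q.Ob} (φ : Chain Q.Hom X Y → M) (p : Chain Q.Hom X Y) : M :=
  sgn K (tri p.length) • φ (ramp p)

/-- The Koszul twist by `1` for shifted arrows. -/
noncomputable def sig {X Y : Q.Ob} (x : Q.Hom X Y) : Q.Hom X Y := sgn K 1 • Q.twist 1 x

@[simp] lemma length_twistChain (k : ℤ) {X Y : Q.Ob} (p : Chain Q.Hom X Y) :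
    (Q.twistChain k p).length = p.length := Chain.length_map _ _

@[simp] lemma length_ramp {X Y : Q.Ob} (p : Chain Q.Hom X Y) : (ramp p).length = p.length := by
  induction p with
  | nil => rfl
  | cons p f ih => simp [ramp, ih]

lemma twistChain_cons (k : ℤ) {X Y Z : Q.Ob} (p : Chain Q.Hom X Y) (f : Q.Hom Y Z) :
    Q.twistChain k (p.cons f) = (Q.twistChain k p).cons (Q.twist k f) := rfl

lemma twistChain_nil (k : ℤ) (X : Q.Ob) :
    Q.twistChain k (.nil X) = .nil X := rfl

lemma twistChain_twistChain (k l : ℤ) {X Y : Q.Ob} (p : Chain Q.Hom X Y) :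
    Q.twistChain k (Q.twistChain l p) = Q.twistChain (k + l) p := by
  induction p with
  | nil => rfl
  | cons p f ih => simp only [twistChain_cons, ih, twist_twist]

lemma twistChain_congr {k l : ℤ} (h : (k : ZMod 2) = l) {X Y : Q.Ob} (p : Chain Q.Hom X Y) :
    Q.twistChain k p = Q.twistChain l p := by
  induction p with
  | nil => rfl
  | cons p f ih => simp only [twistChain_cons, ih, Q.twist_congr h]

lemma twistChain_zero {X Y : Q.Ob} (p : Chain Q.Hom X Y) : Q.twistChain 0 p = p := by
  induction p with
  | nil => rfl
  | cons p f ih => simp only [twistChain_cons, ih, twist_zero]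

lemma twistChain_append (k : ℤ) {X Y Z : Q.Ob} (p : Chain Q.Hom X Y) (q : Chain Q.Hom Y Z) :
    Q.twistChain k (p.append q) = (Q.twistChain k p).append (Q.twistChain k q) :=
  Chain.map_append _ _ _

lemma ramp_twistChain (k : ℤ) {X Y : Q.Ob} (p : Chain Q.Hom X Y) :
    ramp (Q.twistChain k p) = Q.twistChain k (ramp p) := by
  induction p with
  | nil => rfl
  | cons p f ih =>
    simp only [twistChain_cons, ramp, ih, length_twistChain, twist_twist, add_comm k]

lemma ramp_ramp {X Y : Q.Ob} (p : Chain Q.Hom X Y) : ramp (ramp p) = p := by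
  induction p with
  | nil => rfl
  | cons p f ih => simp only [ramp, ih, length_ramp, twist_twist, twist_double]

lemma ramp_append {X Y Z : Q.Ob} (p : Chain Q.Hom X Y) (q : Chain Q.Hom Y Z) :
    ramp (p.append q) = (ramp p).append (Q.twistChain p.length (ramp q)) := by
  induction q with
  | nil => rfl
  | cons q f ih =>
    simp only [Chain.append_cons, ramp, ih, twistChain_cons, twist_twist, Chain.length_append,
      Nat.cast_add]

lemma hat_hat {X Y : Q.Ob} (φ : Chain Q.Hom X Y → M) (p : Chain Q.Hom X Y) :
    hat (fun q => hat φ q) p = φ p := by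
  simp only [hat, ramp_ramp, length_ramp, smul_smul, sgn_mul_self, one_smul]

lemma hat_multilinear {X Y : Q.Ob} {φ : Chain Q.Hom X Y → M} (h : Chain.Multilinear K φ) :
    Chain.Multilinear K (fun p => hat φ p) := by
  intro S T a c
  have h1 : ∀ x : Q.Hom S T, ((a.cons x).append c).length = a.length + 1 + c.length := fun x => by
    rw [Chain.length_append, Chain.length_cons]
  simp only [hat, h1, ramp_append, ramp, Chain.length_cons]
  refine isLinearMap_smul _ ?_
  exact Chain.isLinearMap_comp (f := fun x => φ (((ramp a).cons x).append _)) (h _ _ _ _)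
    (LinearMap.isLinear _)

lemma hasDegree_twistChain {k : ℤ} {X Y : Q.Ob} {p : Chain Q.Hom X Y} {d : ℤ}
    (h : Q.HasDegree p d) : Q.HasDegree (Q.twistChain k p) d := by
  induction p generalizing d with
  | nil => exact h
  | cons p f ih =>
    obtain ⟨e, e', h1, h2, rfl⟩ := h
    refine ⟨e, e', ih h1, ?_, rfl⟩
    simp only [Q.twist_of_mem _ h2]
    exact Submodule.smul_mem _ _ h2

lemma hasDegree_ramp {X Y : Q.Ob} {p : Chain Q.Hom X Y} {d : ℤ}
    (h : Q.HasDegree p d) : Q.HasDegree (ramp p) d := by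
  induction p generalizing d with
  | nil => exact h
  | cons p f ih =>
    obtain ⟨e, e', h1, h2, rfl⟩ := h
    refine ⟨e, e', ih h1, ?_, rfl⟩
    simp only [Q.twist_of_mem _ h2]
    exact Submodule.smul_mem _ _ h2

lemma hat_isDeg {c : ℤ} {F : ∀ {X Y : Q.Ob}, Chain Q.Hom X Y → R.Hom (o X) (o Y)}
    (hd : Q.IsDeg o c F) : Q.IsDeg o c (fun p => hat F p) := by
  intro X Y p d hp
  have := hd X Y (ramp p) d (hasDegree_ramp hp)
  rw [length_ramp] at this
  exact Submodule.smul_mem _ _ this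

lemma sumSplit_ramp {N : Type u} [AddCommMonoid N] {X Y : Q.Ob} (p : Chain Q.Hom X Y)
    (φ : ∀ Z : Q.Ob, Chain Q.Hom X Z → Chain Q.Hom Z Y → N) :
    (ramp p).sumSplit φ =
      p.sumSplit (fun Z a b => φ Z (ramp a) (Q.twistChain a.length (ramp b))) := by
  induction p with
  | nil => rfl
  | cons p f ih =>
    simp only [ramp, Chain.sumSplit, ih]
    congr 1
    refine Chain.sumSplit_congr _ fun Z a b h => ?_
    rw [← h, twistChain_cons, twist_twist, Chain.length_append, Nat.cast_add]

lemma sumSplit_twistChain {N : Type u} [AddCommMonoid N] (k : ℤ) {X Y : Q.Ob} (p : Chain Q.Hom X Y)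
    (φ : ∀ Z : Q.Ob, Chain Q.Hom X Z → Chain Q.Hom Z Y → N) :
    (Q.twistChain k p).sumSplit φ =
      p.sumSplit (fun Z a b => φ Z (Q.twistChain k a) (Q.twistChain k b)) :=
  Chain.sumSplit_map _ _ _

lemma sumSplit_smul (r : K) {X Y : Q.Ob} (p : Chain Q.Hom X Y)
    (φ : ∀ Z : Q.Ob, Chain Q.Hom X Z → Chain Q.Hom Z Y → M) :
    r • p.sumSplit φ = p.sumSplit (fun Z a b => r • φ Z a b) :=
  Chain.map_sumSplit (DistribSMul.toAddMonoidHom M r) p φ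

lemma sgn_pow (n : ℕ) : sgn K 1 ^ n = sgn K n := by
  induction n with
  | zero => simp [sgn_zero]
  | succ n ih => rw [pow_succ, ih, ← sgn_add]; push_cast; rfl

lemma map_sig {X Y : Q.Ob} {φ : Chain Q.Hom X Y → M} (h : Chain.Multilinear K φ)
    (p : Chain Q.Hom X Y) :
    φ (p.map (fun x => sig x)) = sgn K p.length • φ (Q.twistChain 1 p) := by
  rw [← sgn_pow]
  exact h.map_smul (fun x => Q.twist 1 x) (sgn K 1) p

lemma hat_sig {F : ∀ {X Y : Q.Ob}, Chain Q.Hom X Y → R.Hom (o X) (o Y)}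
    (hF : Q.IsMulti o F) (hd : Q.IsDeg o 1 F) {X Y : Q.Ob} (p : Chain Q.Hom X Y) :
    hat F (p.map (fun x => sig x)) = sig (hat F p) := by
  rw [map_sig (φ := fun p => hat F p) (hat_multilinear (hF X Y))]
  rw [twist_apply (F := fun p => hat F p) (fun X Y => hat_multilinear (hF X Y)) (hat_isDeg hd),
    sig, smul_smul, ← sgn_add]
  congr 1
  apply sgn_congr
  push_cast
  ring_nf

/-- The signed coderivation sum becomes the unsigned one for shifted arrows. -/
lemma hat_coderSum {m : ∀ {X Y : Q.Ob}, Chain Q.Hom X Y → Q.Hom X Y}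
    (hm : Q.IsMulti (fun X => X) m) (hd : Q.IsDeg (fun X => X) 2 m)
    {X Y : Q.Ob} {φ : Chain Q.Hom X Y → M} (hφ : Chain.Multilinear K φ) (p : Chain Q.Hom X Y) :
    hat (fun q => Q.coderSum m φ q) p =
      Chain.cod (fun x => sig x) (fun q => hat m q) (fun q => hat φ q) p := by
  have hφ' := hat_multilinear hφ
  simp only [coderSum, Chain.cod]
  rw [hat, sumSplit_ramp, sumSplit_smul]
  refine Chain.sumSplit_congr _ fun Z a bc h => ?_
  rw [sumSplit_twistChain, sumSplit_ramp, sumSplit_smul]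
  refine Chain.sumSplit_congr _ fun W b c h' => ?_
  have h1 := map_sig (hφ'.tail (a.cons (hat m b))) c
  rw [h1, hat, ramp_append, ramp, ramp_twistChain, hat, twist_apply (F := m) hm hd,
    twistChain_twistChain, twistChain_twistChain, twistChain_twistChain, LinearMap.map_smul]
  have h2 := fun c => hφ Z W (ramp a) c
  rw [(h2 _).map_smul, (h2 _).map_smul]
  simp only [length_ramp, length_twistChain, Chain.length_append, Chain.length_cons, ← h, ← h',
    smul_smul, ← sgn_add]
  congr 1
  · apply sgn_congr
    simp only [tri_add, tri]
    push_cast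
    generalize (a.length : ZMod 2) = x
    generalize (b.length : ZMod 2) = y
    generalize (c.length : ZMod 2) = z
    generalize ((tri a.length : ℤ) : ZMod 2) = t
    generalize ((tri b.length : ℤ) : ZMod 2) = t'
    generalize ((tri c.length : ℤ) : ZMod 2) = t''
    revert x y z t t' t''; decide
  · congr 2
    apply twistChain_congr
    push_cast
    generalize (a.length : ZMod 2) = x
    generalize (b.length : ZMod 2) = y
    revert x y; decide

/-- The total length of a decomposition into blocks. -/
def blockLength {Ob : Type u} {V : Ob → Ob → Type u} {X Y : Ob} : Chain (Chain V) X Y → ℕ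
  | .nil _ => 0
  | .cons D b => blockLength D + b.length

/-- `ramp` for decomposed chains. -/
noncomputable def rampBlocks {X Y : Q.Ob} : Chain (Chain Q.Hom) X Y → Chain (Chain Q.Hom) X Y
  | .nil _ => .nil _
  | .cons D b => (rampBlocks D).cons (Q.twistChain (blockLength D) (ramp b))

lemma sumBlocks_congr' {Ob : Type u} {V : Ob → Ob → Type u} {N : Type u} [AddCommMonoid N]
    {X Y : Ob} (p : Chain V X Y) {Φ Ψ : Chain (Chain V) X Y → N}
    (h : ∀ D, blockLength D = p.length → Φ D = Ψ D) : p.sumBlocks Φ = p.sumBlocks Ψ := by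
  induction p with
  | nil => exact h _ rfl
  | cons p f ih =>
    refine ih fun D hD => ?_
    congr 1
    · exact h _ (by simp [blockLength, hD])
    · cases D with
      | nil => rfl
      | cons D b => exact h _ (by simp [blockLength, ← hD, add_assoc])

lemma sumBlocks_ramp {N : Type u} [AddCommMonoid N] {X Y : Q.Ob} (p : Chain Q.Hom X Y)
    (Φ : Chain (Chain Q.Hom) X Y → N) :
    (ramp p).sumBlocks Φ = p.sumBlocks (fun D => Φ (rampBlocks D)) := by
  induction hn : p.length using Nat.strong_induction_on generalizing Y with
  | _ n ih =>
  cases p with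
  | nil => rfl
  | cons p f =>
    rw [ramp, Chain.sumBlocks_cons, sumSplit_ramp, Chain.sumBlocks_cons]
    refine Chain.sumSplit_congr _ fun Z a c h => ?_
    rw [ih a.length _ a _ rfl]
    · refine sumBlocks_congr' _ fun D hD => ?_
      rw [rampBlocks, hD, ramp, twistChain_cons, twist_twist, ← h, Chain.length_append,
        Nat.cast_add]
    · rw [← hn, Chain.length_cons, ← h, Chain.length_append]; omega

/-- An auxiliary sign. -/
def auxSign {Ob : Type u} {V : Ob → Ob → Type u} {X Y : Ob} : Chain (Chain V) X Y → ℤ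
  | .nil _ => 0
  | .cons D b => auxSign D + tri b.length + D.length * (1 - b.length)

lemma auxSign_eq {Ob : Type u} {V : Ob → Ob → Type u} {X Y : Ob} (D : Chain (Chain V) X Y) :
    ((tri (blockLength D) + blockSign D : ℤ) : ZMod 2) = (auxSign D + tri D.length : ℤ) ∧
    blockShift D = D.length - blockLength D := by
  induction D with
  | nil => exact ⟨rfl, rfl⟩
  | cons D b ih =>
    obtain ⟨h1, h2⟩ := ih
    constructor
    · simp only [blockLength, blockSign, auxSign, tri_add, Chain.length_cons, tri, h2]
      push_cast at h1 ⊢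
      have h3 : ((blockSign D : ℤ) : ZMod 2) =
          (auxSign D : ℤ) + (tri D.length : ℤ) - (tri (blockLength D) : ℤ) := by
        rw [← h1]; ring
      rw [h3]
      generalize (b.length : ZMod 2) = x
      generalize (D.length : ZMod 2) = y
      generalize (blockLength D : ZMod 2) = z
      generalize ((tri D.length : ℤ) : ZMod 2) = t
      generalize ((tri b.length : ℤ) : ZMod 2) = t'
      generalize ((tri (blockLength D) : ℤ) : ZMod 2) = t''
      generalize ((auxSign D : ℤ) : ZMod 2) = s
      revert x y z t t' t'' s; decide
    · simp only [blockShift, h2, blockLength, Chain.length_cons]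
      push_cast; ring

lemma length_mapBlocks {Ob Ob' : Type u} {V : Ob → Ob → Type u} {W : Ob' → Ob' → Type u}
    {o : Ob → Ob'} (F : ∀ {X Y : Ob}, Chain V X Y → W (o X) (o Y)) {X Y : Ob}
    (D : Chain (Chain V) X Y) : (Chain.mapBlocks F D).length = D.length := by
  induction D with
  | nil => rfl
  | cons D b ih => simp [Chain.mapBlocks, ih]

lemma length_rampBlocks {X Y : Q.Ob} (D : Chain (Chain Q.Hom) X Y) :
    (rampBlocks D).length = D.length := by
  induction D with
  | nil => rfl
  | cons D b ih => simp [rampBlocks, ih]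

lemma ramp_mapBlocks {F : ∀ {X Y : Q.Ob}, Chain Q.Hom X Y → R.Hom (o X) (o Y)}
    (hF : Q.IsMulti o F) (hd : Q.IsDeg o 1 F) {X Y : Q.Ob}
    {φ : Chain R.Hom (o X) (o Y) → M} (hφ : Chain.Multilinear K φ) (D : Chain (Chain Q.Hom) X Y) :
    φ (ramp (Chain.mapBlocks (fun p => hat F p) (rampBlocks D))) =
      sgn K (auxSign D) • φ (blockMap F D) := by
  induction D with
  | nil => simp [rampBlocks, Chain.mapBlocks, ramp, blockMap, auxSign, sgn_zero]
  | cons D b ih =>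
    rw [rampBlocks, Chain.mapBlocks, ramp, length_mapBlocks, length_rampBlocks, ih (hφ.init _), hat,
      ramp_twistChain, ramp_ramp, length_twistChain, length_ramp, LinearMap.map_smul]
    have h1 := twist_apply (F := F) hF hd D.length (Q.twistChain (blockLength D) b)
    rw [twistChain_twistChain, length_twistChain] at h1
    have h2 : Q.twistChain (D.length + blockLength D) b = Q.twistChain (blockShift D) b := by
      apply twistChain_congr
      rw [(auxSign_eq D).2]
      push_cast
      generalize (D.length : ZMod 2) = y
      generalize (blockLength D : ZMod 2) = z
      revert y z; decide
    have h3 : R.twist D.length (F (Q.twistChain (blockLength D) b)) =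
        sgn K (D.length * (1 - b.length)) • F (Q.twistChain (blockShift D) b) := by
      rw [← h2, h1, smul_smul, sgn_mul_self, one_smul]
    rw [h3, smul_smul, (hφ.last _).map_smul, blockMap, smul_smul, ← sgn_add, ← sgn_add]
    congr 2
    simp only [auxSign]; ring

/-- The signed sum over block decompositions becomes the unsigned one for shifted arrows. -/
lemma hat_blockSum {F : ∀ {X Y : Q.Ob}, Chain Q.Hom X Y → R.Hom (o X) (o Y)}
    (hF : Q.IsMulti o F) (hd : Q.IsDeg o 1 F) {X Y : Q.Ob}
    {φ : Chain R.Hom (o X) (o Y) → M} (hφ : Chain.Multilinear K φ) (p : Chain Q.Hom X Y) :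
    hat (fun q => blockSum F φ q) p = Chain.bs (fun q => hat F q) (fun q => hat φ q) p := by
  have h : ∀ p : Chain Q.Hom X Y, blockSum F φ p =
      hat (fun q => Chain.bs (fun q => hat F q) (fun q => hat φ q) q) p := by
    intro p
    rw [hat, blockSum, Chain.bs, sumBlocks_ramp, ← Chain.sumBlocks_smul]
    refine sumBlocks_congr' _ fun D hD => ?_
    rw [hat, ramp_mapBlocks (F := F) hF hd hφ, length_mapBlocks, length_rampBlocks, smul_smul, smul_smul,
      ← sgn_add, ← sgn_add]
    congr 1
    apply sgn_congr
    have := (auxSign_eq D).1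
    rw [hD] at this
    push_cast at this ⊢
    have h3 : ((blockSign D : ℤ) : ZMod 2) =
        (auxSign D : ℤ) + (tri D.length : ℤ) - (tri p.length : ℤ) := by
      rw [← this]; ring
    rw [h3]
    generalize ((tri D.length : ℤ) : ZMod 2) = t
    generalize ((tri p.length : ℤ) : ZMod 2) = t'
    generalize ((auxSign D : ℤ) : ZMod 2) = s
    revert t t' s; decide
  simp only [h]
  exact hat_hat (φ := fun p => Chain.bs (fun q => hat F q) (fun q => hat φ q) p) p

/-! ### Degrees and units in sums over block decompositions -/

lemma HasDegree.append {X Y Z : Q.Ob} {p : Chain Q.Hom X Y} {q : Chain Q.Hom Y Z} {d : ℤ}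
    (h : Q.HasDegree (p.append q) d) : ∃ e e', Q.HasDegree p e ∧ Q.HasDegree q e' ∧ d = e + e' := by
  induction q generalizing d with
  | nil => exact ⟨d, 0, h, rfl, by simp⟩
  | cons q f ih =>
    obtain ⟨e, e', h1, h2, rfl⟩ := h
    obtain ⟨e1, e2, h3, h4, rfl⟩ := ih h1
    exact ⟨e1, e2 + e', h3, ⟨e2, e', h4, h2, rfl⟩, by ring⟩

lemma sumSplit_mem {V : Type u} [AddCommGroup V] [Module K V] (S : Submodule K V) {X Y : Q.Ob}
    (p : Chain Q.Hom X Y) (φ : ∀ Z : Q.Ob, Chain Q.Hom X Z → Chain Q.Hom Z Y → V)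
    (h : ∀ Z a b, a.append b = p → φ Z a b ∈ S) : p.sumSplit φ ∈ S := by
  induction p with
  | nil => exact h _ _ _ rfl
  | cons p f ih =>
    refine S.add_mem (h _ _ _ rfl) (ih _ fun Z a b hab => h _ _ _ (by simp [hab]))

lemma bs_mem {F : ∀ {X Y : Q.Ob}, Chain Q.Hom X Y → R.Hom (o X) (o Y)}
    (hd : Q.IsDeg o 1 F) {V : Type u} [AddCommGroup V] [Module K V] (S : ℤ → Submodule K V) {c : ℤ}
    {X Y : Q.Ob} (φ : Chain R.Hom (o X) (o Y) → V)
    (hφ : ∀ q d, R.HasDegree q d → φ q ∈ S (d + c - q.length)) (p : Chain Q.Hom X Y) (d : ℤ)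
    (hp : Q.HasDegree p d) : Chain.bs (fun q => F q) φ p ∈ S (d + c - p.length) := by
  induction hn : p.length using Nat.strong_induction_on generalizing Y c d with
  | _ n ih =>
  cases p with
  | nil => subst hn; obtain rfl : d = 0 := hp; exact hφ (.nil _) 0 rfl
  | cons p f =>
    rw [Chain.bs_cons]
    refine sumSplit_mem _ _ _ fun Z a b hab => ?_
    subst hab
    obtain ⟨e1, e2, h1, h2, rfl⟩ := HasDegree.append (q := b.cons f) hp
    have h3 := hd _ _ _ _ h2
    have := ih a.length (by rw [← hn, Chain.length_cons, Chain.length_append]; omega)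
      (c := c + e2 - (b.cons f).length)
      (φ := fun q => φ (q.cons (F (b.cons f)))) ?_ a e1 h1 rfl
    · convert this using 2
      rw [← hn, Chain.length_cons, Chain.length_append, Chain.length_cons]
      push_cast; ring
    · intro q d hq
      have := hφ (q.cons (F (b.cons f))) _ ⟨d, _, hq, h3, rfl⟩
      convert this using 2
      simp only [Chain.length_cons]; push_cast; ring

end GradedQuiver

/-- A non-unital `A_∞` category over `K`. The operation `mᵢ` is the restriction of `m` to chains of
length `i`; on chains of length `0` we put `m = 0`. -/
structure NUAInfCat (K : Type u) [Field K] extends GradedQuiver K where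
  m : ∀ {X Y : Ob}, Chain Hom X Y → Hom X Y
  m_nil : ∀ X : Ob, m (Chain.nil X) = 0
  m_linear : ∀ X Y : Ob, Chain.Multilinear K (fun p : Chain Hom X Y => m p)
  /-- `mᵢ` is of degree `2 - i` -/
  m_degree : ∀ {X Y : Ob} (p : Chain Hom X Y) (d : ℤ), toGradedQuiver.HasDegree p d →
    m p ∈ gr X Y (d + 2 - p.length)
  /-- `∑ (-1)^{jk+l} m_{n-k+1} (id^{⊗ j} ⊗ m_k ⊗ id^{⊗ l}) = 0` -/
  m_rel : ∀ {X Y : Ob} (p : Chain Hom X Y), toGradedQuiver.coderSum m (fun q => m q) p = 0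

/-- A non-unital `A_∞` functor. The component `Fⁱ` is the restriction of `map` to chains of
length `i`; on chains of length `0` we put `map = 0`. -/
structure NUAInfFunctor {K : Type u} [Field K] (A B : NUAInfCat K) where
  obj : A.Ob → B.Ob
  map : ∀ {X Y : A.Ob}, Chain A.Hom X Y → B.Hom (obj X) (obj Y)
  map_nil : ∀ X : A.Ob, map (Chain.nil X) = 0
  map_linear : ∀ X Y : A.Ob, Chain.Multilinear K (fun p : Chain A.Hom X Y => map p)
  /-- `Fⁱ` is of degree `1 - i` -/
  map_degree : ∀ {X Y : A.Ob} (p : Chain A.Hom X Y) (d : ℤ), A.HasDegree p d →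
    map p ∈ B.gr _ _ (d + 1 - p.length)
  /-- `∑ (-1)^{jk+l} F^{n-k+1} (id^{⊗ j} ⊗ m_k ⊗ id^{⊗ l})
    = ∑ (-1)^{∑ᵤ (1 - sᵤ) ∑_{v > u} sᵥ} m_r (F^{s_r} ⊗ ⋯ ⊗ F^{s_1})` -/
  map_rel : ∀ {X Y : A.Ob} (p : Chain A.Hom X Y),
    A.coderSum A.m (fun q => map q) p = GradedQuiver.blockSum map (fun q => B.m q) p

namespace Chain

variable {Ob : Type u} {V : Ob → Ob → Type u}

lemma sumSplit_left_nil {M : Type u} [AddCommMonoid M] {X Y : Ob} (p : Chain V X Y)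
    (φ : ∀ Z : Ob, Chain V X Z → Chain V Z Y → M)
    (h : ∀ Z a b, 1 ≤ a.length → φ Z a b = 0) : sumSplit p φ = φ X (nil X) p := by
  induction p with
  | nil => rfl
  | cons p f ih =>
    rw [sumSplit, h _ _ _ (by simp), ih _ (fun Z a b hab => h _ _ _ hab), zero_add]

lemma sumSplit_right_nil {M : Type u} [AddCommMonoid M] {X Y : Ob} (p : Chain V X Y)
    (φ : ∀ Z : Ob, Chain V X Z → Chain V Z Y → M)
    (h : ∀ Z a b, 1 ≤ b.length → φ Z a b = 0) : sumSplit p φ = φ Y p (nil Y) := by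
  cases p with
  | nil => rfl
  | cons p f =>
    rw [sumSplit, sumSplit_congr p (ψ := fun _ _ _ => 0), sumSplit_zero, add_zero]
    intro Z a b _
    exact h _ _ _ (by simp)

lemma sumSplit_eq_zero {M : Type u} [AddCommMonoid M] {X Y : Ob} (p : Chain V X Y)
    (φ : ∀ Z : Ob, Chain V X Z → Chain V Z Y → M)
    (h : ∀ Z a b, a.append b = p → φ Z a b = 0) : sumSplit p φ = 0 := by
  rw [sumSplit_congr p (ψ := fun _ _ _ => 0) h, sumSplit_zero]

/-- The identity functor on chains: the identity on chains of length one, `0` on all others. -/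
def idMap [∀ X Y, AddCommGroup (V X Y)] {X Y : Ob} : Chain V X Y → V X Y
  | .cons (.nil _) f => f
  | _ => 0

lemma idMap_eq_zero [∀ X Y, AddCommGroup (V X Y)] {X Y : Ob} (p : Chain V X Y)
    (h : p.length ≠ 1) : idMap p = 0 := by
  cases p with
  | nil => rfl
  | cons p f =>
    cases p with
    | nil => exact absurd rfl h
    | cons p g => rfl

variable {K : Type u} [Field K] [∀ X Y, AddCommGroup (V X Y)] [∀ X Y, Module K (V X Y)]

lemma isLinearMap_zero {N M : Type u} [AddCommGroup M] [Module K M] [AddCommGroup N]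
    [Module K N] : IsLinearMap K (fun _ : N => (0 : M)) :=
  ⟨fun _ _ => by simp, fun _ _ => by simp⟩

lemma idMap_multilinear (X Y : Ob) : Multilinear K (fun p : Chain V X Y => idMap p) := by
  intro S T a c
  by_cases h : a.length + c.length = 0
  · cases a with
    | nil =>
      cases c with
      | nil => exact LinearMap.id.isLinear
      | cons c f => simp at h
    | cons a f => simp at h
  · have : ∀ f : V S T, idMap ((a.cons f).append c) = 0 := fun f =>
      idMap_eq_zero _ (by rw [length_append, length_cons]; omega)
    simp only [this]
    exact isLinearMap_zero

variable {Ob' : Type u} {W : Ob' → Ob' → Type u} {o : Ob → Ob'}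
  [∀ X Y, AddCommGroup (W X Y)] [∀ X Y, Module K (W X Y)]
  {M : Type u} [AddCommGroup M] [Module K M]

lemma bs_of_vanish (F : ∀ {X Y : Ob}, Chain V X Y → W (o X) (o Y)) {X Y : Ob}
    (φ : Chain W (o X) (o Y) → M) (h : ∀ q, 1 ≤ q.length → φ q = 0) (p : Chain V X Y)
    (hp : 1 ≤ p.length) : bs F φ p = 0 := by
  cases p with
  | nil => simp at hp
  | cons p f =>
    rw [bs_cons]
    refine sumSplit_eq_zero _ _ fun Z a b _ => ?_
    rw [← bs_zero F a]
    congr 1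
    funext q
    exact h _ (by simp)

lemma bs_idMap_right (F : ∀ {X Y : Ob}, Chain V X Y → W (o X) (o Y))
    (hF : ∀ X, F (nil X) = 0) {X Y : Ob} (p : Chain V X Y) :
    bs F (fun q => idMap q) p = F p := by
  cases p with
  | nil => rw [bs_nil, hF]; rfl
  | cons p f =>
    rw [bs_cons, sumSplit_left_nil]
    · rfl
    · intro Z a b ha
      refine bs_of_vanish F _ (fun q hq => ?_) a ha
      exact idMap_eq_zero _ (by simp; omega)

lemma bs_idMap_left {X Y : Ob} {φ : Chain V X Y → M} (hφ : Multilinear K φ) (p : Chain V X Y) :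
    bs (o := fun X => X) (fun q => idMap q) φ p = φ p := by
  induction p with
  | nil => rfl
  | cons p f ih =>
    rw [bs_cons, sumSplit_right_nil]
    · exact ih (hφ.init f)
    · intro Z a b hb
      rw [← bs_zero (o := fun X => X) (fun q => idMap q) a]
      congr 1
      funext q
      rw [idMap_eq_zero _ (by simp; omega), (hφ.last q).map_zero]

end Chain

namespace NUAInfFunctor

open GradedQuiver

variable {K : Type u} [Field K] {A B C D : NUAInfCat K}

lemma hat_idMap {Q : GradedQuiver K} {X Y : Q.Ob} (p : Chain Q.Hom X Y) :
    hat (fun q => Chain.idMap q) p = Chain.idMap p := by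
  by_cases h : p.length = 1
  · cases p with
    | nil => simp at h
    | cons p f =>
      cases p with
      | nil => simp [hat, ramp, Chain.idMap, tri, sgn_zero, twist_zero]
      | cons p g => simp at h
  · rw [hat, Chain.idMap_eq_zero _ h, Chain.idMap_eq_zero _ (by simpa using h), smul_zero]

lemma hat_inj {Q : GradedQuiver K} {M : Type u} [AddCommGroup M] [Module K M] {X Y : Q.Ob}
    {φ ψ : Chain Q.Hom X Y → M} (h : ∀ p, hat φ p = hat ψ p) (p : Chain Q.Hom X Y) :
    φ p = ψ p := by
  rw [← hat_hat φ p, ← hat_hat ψ p]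
  simp only [h]

lemma isMulti (F : NUAInfFunctor A B) : A.IsMulti (R := B.toGradedQuiver) F.obj F.map :=
  F.map_linear

lemma isDeg (F : NUAInfFunctor A B) : A.IsDeg (R := B.toGradedQuiver) F.obj 1 F.map :=
  fun _ _ => F.map_degree

lemma hat_map_nil (F : NUAInfFunctor A B) (X : A.Ob) : hat (fun q => F.map q) (.nil X) = 0 := by
  rw [hat, ramp, F.map_nil, smul_zero]

lemma hat_m_nil (X : A.Ob) : hat (fun q => A.m q) (.nil X) = 0 := by
  rw [hat, ramp, A.m_nil, smul_zero]

lemma hat_rel (F : NUAInfFunctor A B) {X Y : A.Ob} (p : Chain A.Hom X Y) :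
    Chain.cod (fun x => sig x) (fun q => hat (fun q => A.m q) q)
      (fun q => hat (fun q => F.map q) q) p =
    Chain.bs (fun q => hat (fun q => F.map q) q) (fun q => hat (fun q => B.m q) q) p := by
  rw [← hat_blockSum (F := F.map) F.isMulti F.isDeg (B.m_linear _ _),
    ← hat_coderSum (m := A.m) A.m_linear (fun _ _ => A.m_degree) (F.map_linear X Y)]
  congr 1
  funext q
  exact F.map_rel q

/-- The signed composite is the unsigned one for shifted arrows. -/
lemma hat_comp (F : NUAInfFunctor A B) (G : NUAInfFunctor B C) {X Y : A.Ob} (p : Chain A.Hom X Y) :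
    hat (fun q => blockSum F.map (fun r => G.map r) q) p =
      Chain.bs (fun q => hat (fun q => F.map q) q) (fun q => hat (fun q => G.map q) q) p :=
  hat_blockSum (F := F.map) F.isMulti F.isDeg (G.map_linear _ _) p

lemma comp_eq (F : NUAInfFunctor A B) (G : NUAInfFunctor B C) {X Y : A.Ob} (p : Chain A.Hom X Y) :
    blockSum F.map (fun r => G.map r) p =
      hat (fun q => Chain.bs (fun q => hat (fun q => F.map q) q)
        (fun q => hat (fun q => G.map q) q) q) p := by
  rw [← hat_hat (fun q => blockSum F.map (fun r => G.map r) q) p]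
  congr 1
  funext q
  exact hat_comp F G q

/-- The identity functor. -/
def id (A : NUAInfCat K) : NUAInfFunctor A A where
  obj X := X
  map p := Chain.idMap p
  map_nil _ := rfl
  map_linear := Chain.idMap_multilinear
  map_degree p d hp := by
    by_cases h : p.length = 1
    · cases p with
      | nil => simp at h
      | cons p f =>
        cases p with
        | nil =>
          obtain ⟨e, e', h1, h2, rfl⟩ := hp
          obtain rfl : e = 0 := h1
          simpa [Chain.idMap] using h2
        | cons p g => simp at h
    · rw [Chain.idMap_eq_zero _ h]
      exact Submodule.zero_mem _
  map_rel p := by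
    have h1 : blockSum (Q := A.toGradedQuiver) (R := A.toGradedQuiver) (o := fun X => X)
        (fun q => Chain.idMap q) (fun q => A.m q) p = A.m p := by
      refine hat_inj (φ := fun p => blockSum (Q := A.toGradedQuiver) (R := A.toGradedQuiver)
        (o := fun X => X) (fun q => Chain.idMap q) (fun q => A.m q) p) (ψ := fun p => A.m p)
        (fun p => ?_) p
      rw [hat_blockSum (Q := A.toGradedQuiver) (R := A.toGradedQuiver) (o := fun X => X)
        (F := fun q => Chain.idMap q) Chain.idMap_multilinear ?_ (A.m_linear _ _)]
      · simp only [hat_idMap]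
        exact Chain.bs_idMap_left (hat_multilinear (A.m_linear _ _)) p
      · intro X Y p d hp
        by_cases h : p.length = 1
        · cases p with
          | nil => simp at h
          | cons p f =>
            cases p with
            | nil =>
              obtain ⟨e, e', h1, h2, rfl⟩ := hp
              obtain rfl : e = 0 := h1
              simpa [Chain.idMap] using h2
            | cons p g => simp at h
        · change Chain.idMap p ∈ _
          rw [Chain.idMap_eq_zero _ h]
          exact Submodule.zero_mem _
    rw [h1, coderSum, Chain.sumSplit_left_nil, Chain.sumSplit_right_nil]
    · simp [sgn_zero, twistChain_nil, Chain.idMap]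
    · intro Z a b hb
      rw [Chain.idMap_eq_zero, smul_zero]
      simp [Chain.length_append]; omega
    · intro Z a b ha
      refine Chain.sumSplit_eq_zero _ _ fun W b c _ => ?_
      rw [Chain.idMap_eq_zero, smul_zero]
      simp [Chain.length_append]; omega

/-- Composition of `A_∞` functors:
`(G ∘ F)ⁿ = ∑ (-1)^{∑ᵤ (1 - sᵤ) ∑_{v > u} sᵥ} G^r (F^{s_r} ⊗ ⋯ ⊗ F^{s_1})`. -/
noncomputable def comp (F : NUAInfFunctor A B) (G : NUAInfFunctor B C) : NUAInfFunctor A C where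
  obj X := G.obj (F.obj X)
  map p := blockSum F.map (fun q => G.map q) p
  map_nil X := by
    rw [comp_eq, hat, ramp, Chain.bs_nil, hat_map_nil, smul_zero]
  map_linear X Y := by
    simp only [comp_eq]
    exact hat_multilinear (Chain.Multilinear.bs (fun _ _ => hat_multilinear (F.map_linear _ _))
      (hat_multilinear (G.map_linear _ _)))
  map_degree p d hp := by
    rw [comp_eq]
    refine hat_isDeg (Q := A.toGradedQuiver) (R := C.toGradedQuiver)
      (o := fun X => G.obj (F.obj X)) (c := 1)
      (F := fun q => Chain.bs (fun q => hat (fun q => F.map q) q)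
        (fun q => hat (fun q => G.map q) q) q) ?_ _ _ p d hp
    intro X Y p d hp
    exact bs_mem (hat_isDeg F.isDeg) (C.gr _ _) _ (fun q e hq => hat_isDeg G.isDeg _ _ q e hq) p d hp
  map_rel {X Y} p := by
    have hm : A.IsMulti (R := C.toGradedQuiver) (fun X => G.obj (F.obj X))
        (fun q => blockSum F.map (fun r => G.map r) q) := by
      intro X Y
      simp only [comp_eq]
      exact hat_multilinear (Chain.Multilinear.bs (fun _ _ => hat_multilinear (F.map_linear _ _))
        (hat_multilinear (G.map_linear _ _)))
    have hd : A.IsDeg (R := C.toGradedQuiver) (fun X => G.obj (F.obj X)) 1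
        (fun q => blockSum F.map (fun r => G.map r) q) := by
      simp only [comp_eq]
      refine hat_isDeg (Q := A.toGradedQuiver) (R := C.toGradedQuiver)
        (o := fun X => G.obj (F.obj X)) (c := 1)
        (F := fun q => Chain.bs (fun q => hat (fun q => F.map q) q)
        (fun q => hat (fun q => G.map q) q) q) ?_
      intro X Y p d hp
      exact bs_mem (hat_isDeg F.isDeg) (C.gr _ _) _ (fun q e hq => hat_isDeg G.isDeg _ _ q e hq)
        p d hp
    refine hat_inj (φ := fun p => A.coderSum A.m
      (fun q => blockSum F.map (fun r => G.map r) q) p)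
      (ψ := fun p => blockSum (fun q => blockSum F.map (fun r => G.map r) q) (fun q => C.m q) p)
      (fun p => ?_) p
    rw [hat_coderSum (m := A.m) A.m_linear (fun _ _ => A.m_degree) (hm _ _),
      hat_blockSum (F := fun q => blockSum F.map (fun r => G.map r) q) hm hd (C.m_linear _ _)]
    simp only [hat_comp]
    rw [← Chain.bs_cod (F := fun q => hat (fun q => F.map q) q) (σ' := fun x => sig x)
      (B' := fun q => hat (fun q => B.m q) q) hat_m_nil hat_m_nil
      (fun _ _ => hat_multilinear (F.map_linear _ _)) (fun _ _ p => hat_sig F.isMulti F.isDeg p)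
      (fun _ _ p => hat_rel F p) (hat_multilinear (G.map_linear _ _))]
    simp only [hat_rel]
    exact (Chain.bs_bs (hat_multilinear (C.m_linear _ _)) p).symm

lemma ext_map {F G : NUAInfFunctor A B} (h : F.obj = G.obj)
    (h' : ∀ (X Y : A.Ob) (p : Chain A.Hom X Y), HEq (F.map p) (G.map p)) : F = G := by
  obtain ⟨o, m, _, _, _, _⟩ := F
  obtain ⟨o', m', _, _, _, _⟩ := G
  obtain rfl : o = o' := h
  obtain rfl : @m = @m' := by
    funext X Y p
    exact eq_of_heq (h' X Y p)
  rfl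

lemma id_comp (F : NUAInfFunctor A B) : comp (id A) F = F := by
  refine ext_map rfl fun X Y p => heq_of_eq ?_
  change blockSum (id A).map (fun q => F.map q) p = F.map p
  rw [comp_eq, ← hat_hat (fun q => F.map q) p]
  congr 1
  funext q
  have : (fun {X Y : A.Ob} (q : Chain A.Hom X Y) => hat (fun q => (id A).map q) q) =
      fun {X Y : A.Ob} (q : Chain A.Hom X Y) => Chain.idMap q := by
    funext X Y q; exact hat_idMap q
  exact (congrArg (fun (T : ∀ {X Y : A.Ob}, Chain A.Hom X Y → A.Hom X Y) =>
    Chain.bs (o := fun X => X) (fun q => T q) (fun q => hat (fun q => F.map q) q) q) this).trans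
    (Chain.bs_idMap_left (hat_multilinear (F.map_linear _ _)) q)

lemma comp_id (F : NUAInfFunctor A B) : comp F (id B) = F := by
  refine ext_map rfl fun X Y p => heq_of_eq ?_
  change blockSum F.map (fun q => (id B).map q) p = F.map p
  rw [comp_eq, ← hat_hat (fun q => F.map q) p]
  congr 1
  funext q
  have : (fun q : Chain B.Hom (F.obj X) (F.obj Y) => hat (fun q => (id B).map q) q) =
      fun q => Chain.idMap q := by
    funext q; exact hat_idMap q
  exact (congrArg (fun T => Chain.bs (fun q => hat (fun q => F.map q) q) T q) this).trans
    (Chain.bs_idMap_right (fun q => hat (fun q => F.map q) q) F.hat_map_nil q)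

lemma bs_congr_left {Ob Ob' : Type u} {V : Ob → Ob → Type u} {W : Ob' → Ob' → Type u} {o : Ob → Ob'}
    {M : Type u} [AddCommMonoid M] {T T' : ∀ {X Y : Ob}, Chain V X Y → W (o X) (o Y)}
    (h : (fun {X Y : Ob} (p : Chain V X Y) => T p) = fun {X Y : Ob} (p : Chain V X Y) => T' p)
    {X Y : Ob} (φ : Chain W (o X) (o Y) → M) (p : Chain V X Y) :
    Chain.bs (fun p => T p) φ p = Chain.bs (fun p => T' p) φ p := by
  have : @T = @T' := h
  subst this
  rfl

lemma comp_assoc (F : NUAInfFunctor A B) (G : NUAInfFunctor B C) (H : NUAInfFunctor C D) :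
    comp (comp F G) H = comp F (comp G H) := by
  refine ext_map rfl fun X Y p => heq_of_eq ?_
  have h1 : (fun {X Y : A.Ob} (q : Chain A.Hom X Y) => hat (fun q => (comp F G).map q) q) =
      fun {X Y : A.Ob} (q : Chain A.Hom X Y) =>
        Chain.bs (fun q => hat (fun q => F.map q) q) (fun q => hat (fun q => G.map q) q) q := by
    funext X Y q; exact hat_comp F G q
  have h2 : (fun q : Chain B.Hom (F.obj X) (F.obj Y) => hat (fun q => (comp G H).map q) q) =
      fun q => Chain.bs (fun q => hat (fun q => G.map q) q) (fun q => hat (fun q => H.map q) q) q := by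
    funext q; exact hat_comp G H q
  have e1 := comp_eq (comp F G) H p
  have e2 := comp_eq F (comp G H) p
  refine e1.trans (Eq.trans ?_ e2.symm)
  refine congrArg (fun T : Chain A.Hom X Y → _ => hat T p) (funext fun q => ?_)
  refine (bs_congr_left h1 _ q).trans ?_
  refine Eq.trans ?_ (congrArg (fun T => Chain.bs (fun q => hat (fun q => F.map q) q) T q) h2.symm)
  exact Chain.bs_bs (o := F.obj) (o' := G.obj) (F := fun q => hat (fun q => F.map q) q)
    (G := fun q => hat (fun q => G.map q) q) (φ := fun q => hat (fun q => H.map q) q)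
    (hat_multilinear (H.map_linear _ _)) q

end NUAInfFunctor

/-- The category of non-unital `A_∞` categories and non-unital `A_∞` functors. -/
noncomputable instance (K : Type u) [Field K] : Category (NUAInfCat K) where
  Hom A B := NUAInfFunctor A B
  id A := NUAInfFunctor.id A
  comp F G := NUAInfFunctor.comp F G
  id_comp := NUAInfFunctor.id_comp
  comp_id := NUAInfFunctor.comp_id
  assoc := NUAInfFunctor.comp_assoc

/-! ### Strictly unital `A_∞` categories -/

/-- An object of the category of strictly unital `A_∞` categories. -/
structure ACat (K : Type u) [Field K] extends NUAInfCat K where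
  one : ∀ X : Ob, Hom X X
  one_degree : ∀ X : Ob, one X ∈ gr X X 0
  m_one : ∀ X : Ob, m ((Chain.nil X).cons (one X)) = 0
  m_comp_one : ∀ {X Y : Ob} (f : Hom X Y), m (((Chain.nil X).cons (one X)).cons f) = f
  m_one_comp : ∀ {X Y : Ob} (f : Hom X Y), m (((Chain.nil X).cons f).cons (one Y)) = f
  /-- `mᵢ (…, id, …) = 0` for `i > 2` -/
  m_insert_one : ∀ {X Y Z : Ob} (a : Chain Hom X Y) (c : Chain Hom Y Z),
    2 < a.length + 1 + c.length → m ((a.cons (one Y)).append c) = 0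

/-- Strictly unital `A_∞` functors. -/
structure NUAInfFunctor.StrictlyUnital {K : Type u} [Field K] {A B : ACat K}
    (F : NUAInfFunctor A.toNUAInfCat B.toNUAInfCat) : Prop where
  map_one : ∀ X : A.Ob, F.map ((Chain.nil X).cons (A.one X)) = B.one (F.obj X)
  /-- `Fⁱ (…, id, …) = 0` for `i > 1` -/
  map_insert_one : ∀ {X Y Z : A.Ob} (a : Chain A.Hom X Y) (c : Chain A.Hom Y Z),
    1 < a.length + 1 + c.length → F.map ((a.cons (A.one Y)).append c) = 0

namespace Chain

variable {Ob : Type u} {V : Ob → Ob → Type u} {Ob' : Type u} {W : Ob' → Ob' → Type u}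
  {o : Ob → Ob'} {K : Type u} [Field K]
  [∀ X Y, AddCommGroup (V X Y)] [∀ X Y, Module K (V X Y)]
  [∀ X Y, AddCommGroup (W X Y)] [∀ X Y, Module K (W X Y)]
  {M : Type u} [AddCommGroup M] [Module K M]

lemma bs_insert_one {F : ∀ {X Y : Ob}, Chain V X Y → W (o X) (o Y)}
    (one : ∀ X, V X X) (one' : ∀ X, W X X)
    (h1 : ∀ X, F ((nil X).cons (one X)) = one' (o X))
    (h2 : ∀ (X Y Z : Ob) (a : Chain V X Y) (c : Chain V Y Z), 1 < a.length + 1 + c.length →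
      F ((a.cons (one Y)).append c) = 0) {X Y Z : Ob} (φ : Chain W (o X) (o Z) → M)
    (hφ : Multilinear K φ)
    (h : ∀ (T : Ob') (a : Chain W (o X) T) (c : Chain W T (o Z)),
      φ ((a.cons (one' T)).append c) = 0) (a : Chain V X Y) (c : Chain V Y Z) :
    bs F φ ((a.cons (one Y)).append c) = 0 := by
  induction hn : c.length using Nat.strong_induction_on generalizing Z with
  | _ n ih =>
  cases c with
  | nil =>
    rw [append_nil, bs_cons]
    refine sumSplit_eq_zero _ _ fun T a' c' _ => ?_
    rw [← bs_zero F a']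
    congr 1
    funext q
    cases c' with
    | nil => rw [h1]; exact h _ q (nil _)
    | cons c' f =>
      have := h2 _ _ _ (c'.cons f) (nil _) (by simp)
      rw [append_nil] at this
      rw [this, (hφ.last q).map_zero]
  | cons c f =>
    rw [append_cons, bs_cons, sumSplit_append_cons, sumSplit_eq_zero, sumSplit_eq_zero, add_zero]
    · intro T a₁ a₂ _
      rw [← bs_zero F a₁]
      congr 1
      funext q
      have := h2 _ _ _ a₂ (c.cons f) (by simp; omega)
      rw [append_cons] at this
      rw [this, (hφ.last q).map_zero]
    · intro T c₁ c₂ hc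
      refine ih c₁.length ?_ _ (hφ.init _) (fun T a c => h T a (c.cons (F (c₂.cons f)))) c₁ rfl
      rw [← hn, length_cons, ← hc, length_append]; omega

lemma bs_insert_one' {F : ∀ {X Y : Ob}, Chain V X Y → W (o X) (o Y)}
    (one : ∀ X, V X X) (one' : ∀ X, W X X)
    (h1 : ∀ X, F ((nil X).cons (one X)) = one' (o X))
    (h2 : ∀ (X Y Z : Ob) (a : Chain V X Y) (c : Chain V Y Z), 1 < a.length + 1 + c.length →
      F ((a.cons (one Y)).append c) = 0) {X Y Z : Ob} (φ : Chain W (o X) (o Z) → M)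
    (hφ : Multilinear K φ)
    (h : ∀ (T : Ob') (a : Chain W (o X) T) (c : Chain W T (o Z)), 1 < a.length + 1 + c.length →
      φ ((a.cons (one' T)).append c) = 0) (a : Chain V X Y) (c : Chain V Y Z)
    (hac : 1 < a.length + 1 + c.length) :
    bs F φ ((a.cons (one Y)).append c) = 0 := by
  cases c with
  | nil =>
    rw [append_nil, bs_cons]
    refine sumSplit_eq_zero _ _ fun T a' c' hac' => ?_
    cases c' with
    | nil =>
      rw [h1]
      refine bs_of_vanish F _ (fun q hq => ?_) _ ?_
      · exact h _ q (nil _) (by simp; omega)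
      · rw [append_nil] at hac'
        subst hac'
        simp at hac; omega
    | cons c' f =>
      have := h2 _ _ _ (c'.cons f) (nil _) (by simp)
      rw [append_nil] at this
      rw [this]
      refine Eq.trans ?_ (bs_zero F a')
      congr 1
      funext q
      exact (hφ.last q).map_zero
  | cons c f =>
    rw [append_cons, bs_cons, sumSplit_append_cons, sumSplit_eq_zero, sumSplit_eq_zero, add_zero]
    · intro T a₁ a₂ _
      rw [← bs_zero F a₁]
      congr 1
      funext q
      have := h2 _ _ _ a₂ (c.cons f) (by simp; omega)
      rw [append_cons] at this
      rw [this, (hφ.last q).map_zero]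
    · intro T c₁ c₂ hcc
      exact bs_insert_one (K := K) one one' h1 h2 _ (hφ.init _)
        (fun T a c => h T a (c.cons (F (c₂.cons f))) (by simp; omega)) a c₁

end Chain

namespace NUAInfFunctor

open GradedQuiver

section

variable {K : Type u} [Field K]

lemma hat_one {Q : GradedQuiver K} {M : Type u} [AddCommGroup M] [Module K M] {X Y : Q.Ob}
    (φ : Chain Q.Hom X Y → M) (f : Q.Hom X Y) :
    hat φ ((Chain.nil X).cons f) = φ ((Chain.nil X).cons f) := by
  simp [hat, ramp, tri, sgn_zero, twist_zero]

lemma hat_insert {Q : GradedQuiver K} {M : Type u} [AddCommGroup M] [Module K M]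
    (one : ∀ X : Q.Ob, Q.Hom X X) (h1 : ∀ X, one X ∈ Q.gr X X 0) {X Z : Q.Ob}
    (φ : Chain Q.Hom X Z → M) (n : ℕ)
    (h : ∀ (Y : Q.Ob) (a : Chain Q.Hom X Y) (c : Chain Q.Hom Y Z), n < a.length + 1 + c.length →
      φ ((a.cons (one Y)).append c) = 0) (Y : Q.Ob) (a : Chain Q.Hom X Y) (c : Chain Q.Hom Y Z)
    (hac : n < a.length + 1 + c.length) : hat φ ((a.cons (one Y)).append c) = 0 := by
  rw [hat, ramp_append, ramp, Q.twist_of_mem _ (h1 _), mul_zero, sgn_zero, one_smul, h, smul_zero]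
  simpa using hac

end

variable {K : Type u} [Field K] {A B C : ACat K}

lemma StrictlyUnital.id (A : ACat K) :
    StrictlyUnital (A := A) (B := A) (NUAInfFunctor.id A.toNUAInfCat) where
  map_one _ := rfl
  map_insert_one a c h := Chain.idMap_eq_zero _ (by
    rw [Chain.length_append, Chain.length_cons]; omega)

lemma StrictlyUnital.comp {F : NUAInfFunctor A.toNUAInfCat B.toNUAInfCat}
    {G : NUAInfFunctor B.toNUAInfCat C.toNUAInfCat}
    (hF : F.StrictlyUnital) (hG : G.StrictlyUnital) :
    StrictlyUnital (A := A) (B := C) (NUAInfFunctor.comp F G) where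
  map_one X := by
    change blockSum F.map (fun q => G.map q) _ = _
    rw [comp_eq, hat_one, Chain.bs_cons]
    simp only [Chain.sumSplit, Chain.bs_nil]
    rw [hat_one, hat_one, hF.map_one, hG.map_one]
    rfl
  map_insert_one {X Y Z} a c h := by
    change blockSum F.map (fun q => G.map q) _ = _
    rw [comp_eq]
    refine hat_insert A.one A.one_degree _ 1 (fun Y a c h => ?_) Y a c h
    refine Chain.bs_insert_one' (K := K) A.one B.one ?_ ?_ _ (hat_multilinear (G.map_linear _ _)) ?_
      a c h
    · intro X
      rw [hat_one]; exact hF.map_one X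
    · intro X Y Z a c h
      exact hat_insert A.one A.one_degree _ 1 (fun _ a c h => hF.map_insert_one a c h) Y a c h
    · intro Y a c h
      exact hat_insert B.one B.one_degree _ 1 (fun _ a c h => hG.map_insert_one a c h) Y a c h

end NUAInfFunctor

/-- The category of strictly unital `A_∞` categories and strictly unital `A_∞` functors. -/
noncomputable instance (K : Type u) [Field K] : Category (ACat K) where
  Hom A B := {F : NUAInfFunctor A.toNUAInfCat B.toNUAInfCat // F.StrictlyUnital}
  id A := ⟨NUAInfFunctor.id A.toNUAInfCat, .id A⟩
  comp F G := ⟨NUAInfFunctor.comp F.1 G.1, F.2.comp G.2⟩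
  id_comp F := Subtype.ext (NUAInfFunctor.id_comp F.1)
  comp_id F := Subtype.ext (NUAInfFunctor.comp_id F.1)
  assoc F G H := Subtype.ext (NUAInfFunctor.comp_assoc F.1 G.1 H.1)

/-! ### Cohomologically unital `A_∞` categories -/

/-- The class of `e` in the cohomology of `A (X, X)` is a (two-sided) identity of `X` in the
graded category `H(A)`: the composition of `H(A)` is induced by `m₂`, two cocycles define the same
class when they differ by a coboundary `m₁ h`. -/
structure NUAInfCat.IsCohUnit {K : Type u} [Field K] (A : NUAInfCat K) (X : A.Ob)
    (e : A.Hom X X) : Prop where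
  degree : e ∈ A.gr X X 0
  closed : A.m ((Chain.nil X).cons e) = 0
  right_unit : ∀ {Y : A.Ob} (f : A.Hom X Y), A.m ((Chain.nil X).cons f) = 0 →
    ∃ h : A.Hom X Y, A.m (((Chain.nil X).cons e).cons f) - f = A.m ((Chain.nil X).cons h)
  left_unit : ∀ {Y : A.Ob} (f : A.Hom Y X), A.m ((Chain.nil Y).cons f) = 0 →
    ∃ h : A.Hom Y X, A.m (((Chain.nil Y).cons f).cons e) - f = A.m ((Chain.nil Y).cons h)

/-- An object of the category of cohomologically unital `A_∞` categories. -/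
structure ACatC (K : Type u) [Field K] extends NUAInfCat K where
  exists_unit : ∀ X : Ob, ∃ e : Hom X X, toNUAInfCat.IsCohUnit X e

/-- An `A_∞` functor `F` is cohomologically unital if `H(F)`, which is induced by `F¹`, preserves
identities. -/
def NUAInfFunctor.CohUnital {K : Type u} [Field K] {A B : NUAInfCat K}
    (F : NUAInfFunctor A B) : Prop :=
  ∀ (X : A.Ob) (e : A.Hom X X), A.IsCohUnit X e →
    B.IsCohUnit (F.obj X) (F.map ((Chain.nil X).cons e))

namespace NUAInfFunctor

open GradedQuiver

variable {K : Type u} [Field K]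

lemma comp_map_one {A B C : NUAInfCat K} (F : NUAInfFunctor A B) (G : NUAInfFunctor B C) {X Y : A.Ob}
    (f : A.Hom X Y) : (comp F G).map ((Chain.nil X).cons f) =
      G.map ((Chain.nil _).cons (F.map ((Chain.nil X).cons f))) := by
  change blockSum F.map (fun q => G.map q) _ = _
  rw [comp_eq, hat_one, Chain.bs_cons]
  simp only [Chain.sumSplit, Chain.bs_nil]
  rw [hat_one, hat_one]

lemma CohUnital.id (A : NUAInfCat K) : (NUAInfFunctor.id A).CohUnital := fun _ _ h => h

lemma CohUnital.comp {A B C : NUAInfCat K} {F : NUAInfFunctor A B} {G : NUAInfFunctor B C}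
    (hF : F.CohUnital) (hG : G.CohUnital) : (NUAInfFunctor.comp F G).CohUnital := by
  intro X e he
  rw [comp_map_one]
  exact hG _ _ (hF _ _ he)

end NUAInfFunctor

/-- The category of cohomologically unital `A_∞` categories and cohomologically unital
`A_∞` functors. -/
noncomputable instance (K : Type u) [Field K] : Category (ACatC K) where
  Hom A B := {F : NUAInfFunctor A.toNUAInfCat B.toNUAInfCat // F.CohUnital}
  id A := ⟨NUAInfFunctor.id A.toNUAInfCat, .id _⟩
  comp F G := ⟨NUAInfFunctor.comp F.1 G.1, F.2.comp G.2⟩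
  id_comp F := Subtype.ext (NUAInfFunctor.id_comp F.1)
  comp_id F := Subtype.ext (NUAInfFunctor.comp_id F.1)
  assoc F G H := Subtype.ext (NUAInfFunctor.comp_assoc F.1 G.1 H.1)

/-! ### Strictly unital implies cohomologically unital -/

section inclusion

open GradedQuiver

variable {K : Type u} [Field K]

lemma NUAInfCat.m_cons_zero (A : NUAInfCat K) {X Y Z : A.Ob} (p : Chain A.Hom X Y) :
    A.m (p.cons (0 : A.Hom Y Z)) = 0 := ((A.m_linear _ _).last p).map_zero

lemma NUAInfCat.leibniz (A : NUAInfCat K) {X Y Z : A.Ob} (f : A.Hom X Y) (g : A.Hom Y Z) :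
    A.m ((Chain.nil _).cons (A.m (((Chain.nil _).cons f).cons g))) =
      A.m (((Chain.nil _).cons f).cons (A.m ((Chain.nil _).cons g))) +
      A.m (((Chain.nil _).cons (A.m ((Chain.nil _).cons f))).cons (A.twist 1 g)) := by
  have h := A.m_rel (((Chain.nil _).cons f).cons g)
  have z : A.m (((Chain.nil _).cons (0 : A.Hom X X)).cons (A.twist 2 f)) = 0 := by
    exact ((A.m_linear X Y) _ _ (.nil _) ((Chain.nil _).cons (A.twist 2 f))).map_zero
  have z1 : ∀ x : A.Hom X Y, ∀ y : A.Hom Y Z,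
      A.m ((((Chain.nil X).cons (0 : A.Hom X X)).cons x).cons y) = 0 := fun x y =>
    ((A.m_linear X Z) _ _ (.nil _) (((Chain.nil _).cons x).cons y)).map_zero
  have z2 : ∀ x : A.Hom X Y, ∀ y : A.Hom Y Z,
      A.m ((((Chain.nil X).cons x).cons (0 : A.Hom Y Y)).cons y) = 0 := fun x y =>
    ((A.m_linear X Z) _ _ ((Chain.nil _).cons x) ((Chain.nil _).cons y)).map_zero
  have s1 : sgn K 1 = -1 := by simp [sgn]
  simp [coderSum, Chain.sumSplit, A.m_nil, twistChain_nil, twistChain_cons, z1, z2,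
    A.m_cons_zero, s1, sgn_zero] at h
  rw [← sub_eq_zero, ← h]
  abel

lemma NUAInfFunctor.map_m_one {A B : NUAInfCat K} (F : NUAInfFunctor A B) {X Y : A.Ob}
    (f : A.Hom X Y) : F.map ((Chain.nil _).cons (A.m ((Chain.nil _).cons f))) =
      B.m ((Chain.nil _).cons (F.map ((Chain.nil _).cons f))) := by
  have h := F.map_rel ((Chain.nil _).cons f)
  have z : ∀ x : A.Hom X Y, F.map (((Chain.nil X).cons (0 : A.Hom X X)).cons x) = 0 := fun x =>
    ((F.map_linear X Y) _ _ (.nil _) ((Chain.nil _).cons x)).map_zero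
  have z' : ∀ x : A.Hom X Y, F.map (((Chain.nil X).cons x).cons (0 : A.Hom Y Y)) = 0 := fun x =>
    ((F.map_linear X Y).last _).map_zero
  simpa [coderSum, Chain.sumSplit, A.m_nil, twistChain_nil, twistChain_cons, z, z', sgn_zero,
    blockSum, Chain.sumBlocks, Chain.extendLast, blockSign, blockMap, blockShift, twist_zero] using h

lemma NUAInfCat.m_twist (A : NUAInfCat K) {X Y : A.Ob} (f : A.Hom X Y)
    (hf : A.m ((Chain.nil _).cons f) = 0) : A.m ((Chain.nil _).cons (A.twist 1 f)) = 0 := by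
  have := twist_apply (F := A.m) A.m_linear (fun _ _ => A.m_degree) 1 ((Chain.nil _).cons f)
  rw [hf, map_zero, smul_zero] at this
  exact this

/-- A degree zero element which differs from a strict unit by a coboundary is a unit in
cohomology. -/
lemma ACat.isCohUnit (B : ACat K) {X : B.Ob} (e h : B.Hom X X) (he : e ∈ B.gr X X 0)
    (hh : e - B.one X = B.m ((Chain.nil X).cons h)) : B.IsCohUnit X e := by
  have e0 : e = B.one X + B.m ((Chain.nil X).cons h) := by rw [← hh]; abel
  have sq : ∀ x : B.Hom X X, B.m ((Chain.nil _).cons (B.m ((Chain.nil _).cons x))) = 0 := by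
    intro x
    have h := B.m_rel ((Chain.nil _).cons x)
    have z : ∀ x : B.Hom X X, B.m (((Chain.nil X).cons (0 : B.Hom X X)).cons x) = 0 := fun x =>
      ((B.m_linear X X) _ _ (.nil _) ((Chain.nil _).cons x)).map_zero
    simpa [coderSum, Chain.sumSplit, B.m_nil, twistChain_nil, twistChain_cons, z,
      B.m_cons_zero, sgn_zero] using h
  have one_lin : ∀ {Y Z : B.Ob}, IsLinearMap K (fun x : B.Hom Y Z => B.m ((Chain.nil Y).cons x)) :=
    (B.m_linear _ _).last _
  refine ⟨he, ?_, fun {Y} f hf => ?_, fun {Y} f hf => ?_⟩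
  · rw [e0, one_lin.map_add, B.m_one, sq, add_zero]
  · refine ⟨B.m (((Chain.nil X).cons h).cons (B.twist 1 f)), ?_⟩
    rw [B.leibniz, B.m_twist f hf, B.m_cons_zero, twist_twist, B.twist_double, zero_add, e0]
    have e1 := (B.m_linear X Y X X (.nil _) ((Chain.nil _).cons f)).map_add (B.one X)
      (B.m ((Chain.nil X).cons h))
    simp only [Chain.append_cons, Chain.append_nil, B.m_comp_one] at e1
    rw [e1]; abel
  · refine ⟨B.m (((Chain.nil Y).cons f).cons h), ?_⟩
    rw [B.leibniz, hf, e0, ((B.m_linear _ _).last _).map_add, B.m_one_comp]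
    have : B.m (((Chain.nil Y).cons (0 : B.Hom Y X)).cons (B.twist 1 h)) = 0 :=
      ((B.m_linear Y X) _ _ (.nil _) ((Chain.nil _).cons (B.twist 1 h))).map_zero
    rw [this]; abel

lemma ACat.isCohUnit_one (B : ACat K) (X : B.Ob) : B.IsCohUnit X (B.one X) :=
  B.isCohUnit _ 0 (B.one_degree X) (by rw [B.m_cons_zero, sub_self])

/-- Strictly unital functors are cohomologically unital. -/
lemma NUAInfFunctor.StrictlyUnital.cohUnital {A B : ACat K}
    {F : NUAInfFunctor A.toNUAInfCat B.toNUAInfCat} (hF : F.StrictlyUnital) : F.CohUnital := by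
  intro X e he
  obtain ⟨h, hh⟩ := he.right_unit (A.one X) (A.m_one X)
  rw [A.m_one_comp] at hh
  have hd := F.map_degree ((Chain.nil X).cons e) 0 ⟨0, 0, rfl, he.degree, by simp⟩
  refine B.isCohUnit _ (F.map ((Chain.nil X).cons h)) (by simpa using hd) ?_
  rw [← hF.map_one, ← ((F.map_linear _ _).last _).map_sub, hh, F.map_m_one]

/-- The inclusion of strictly unital into cohomologically unital `A_∞` categories. -/
noncomputable def ACat.toACatC (K : Type u) [Field K] : ACat K ⥤ ACatC K where
  obj A := { A.toNUAInfCat with exists_unit := fun X => ⟨A.one X, A.isCohUnit_one X⟩ }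
  map F := ⟨F.1, F.2.cohUnital⟩
  map_id _ := rfl
  map_comp _ _ := rfl

end inclusion

/-! ### Graded categories as strictly unital `A_∞` categories -/

/-- A graded `K`-linear category. -/
structure GradedCat (K : Type u) [Field K] extends GradedQuiver K where
  /-- the composition `comp f g = g ∘ f` -/
  comp : ∀ {X Y Z : Ob}, Hom X Y →ₗ[K] Hom Y Z →ₗ[K] Hom X Z
  one : ∀ X : Ob, Hom X X
  comp_mem : ∀ {X Y Z : Ob} {d e : ℤ} {f : Hom X Y} {g : Hom Y Z}, f ∈ gr X Y d → g ∈ gr Y Z e →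
    comp f g ∈ gr X Z (d + e)
  one_mem : ∀ X : Ob, one X ∈ gr X X 0
  assoc : ∀ {X Y Z W : Ob} (f : Hom X Y) (g : Hom Y Z) (h : Hom Z W),
    comp (comp f g) h = comp f (comp g h)
  one_comp : ∀ {X Y : Ob} (f : Hom X Y), comp (one X) f = f
  comp_one : ∀ {X Y : Ob} (f : Hom X Y), comp f (one Y) = f

namespace GradedCat

open GradedQuiver

variable {K : Type u} [Field K] (P : GradedCat K)

/-- The operations `m₂ (g, f) = g ∘ f` and `mᵢ = 0` for `i ≠ 2`. -/
def opMap {X Y : P.Ob} : Chain P.Hom X Y → P.Hom X Y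
  | .cons (.cons (.nil _) f) g => P.comp f g
  | _ => 0

lemma opMap_eq_zero {X Y : P.Ob} (p : Chain P.Hom X Y) (h : p.length ≠ 2) : P.opMap p = 0 := by
  cases p with
  | nil => rfl
  | cons p f =>
    cases p with
    | nil => rfl
    | cons p g =>
      cases p with
      | nil => exact absurd rfl h
      | cons p h => rfl

lemma opMap_multilinear (X Y : P.Ob) :
    Chain.Multilinear K (fun p : Chain P.Hom X Y => P.opMap p) := by
  intro S T a c
  by_cases h : a.length + c.length = 1
  · cases c with
    | nil =>
      cases a with
      | nil => simp at h
      | cons a g =>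
        cases a with
        | nil => exact (P.comp g).isLinear
        | cons a g' => simp at h
    | cons c f =>
      cases c with
      | nil =>
        cases a with
        | nil => exact (P.comp.flip f).isLinear
        | cons a g' => simp at h
      | cons c g => simp at h; omega
  · have : ∀ f : P.Hom S T, P.opMap ((Chain.cons a f).append c) = 0 := fun f =>
      P.opMap_eq_zero _ (by rw [Chain.length_append, Chain.length_cons]; omega)
    simp only [this]
    exact Chain.isLinearMap_zero

/-- A graded category, as a strictly unital `A_∞` category: the composition is `m₂`, and all the
other operations (in particular the differential `m₁`) vanish. -/
def toACat : ACat K where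
  toGradedQuiver := P.toGradedQuiver
  m p := P.opMap p
  m_nil _ := rfl
  m_linear := P.opMap_multilinear
  m_degree {X Y} p d hp := by
    by_cases h : p.length = 2
    · cases p with
      | nil => simp at h
      | cons p f =>
        cases p with
        | nil => simp at h
        | cons p g =>
          cases p with
          | nil =>
            obtain ⟨e, e', ⟨e1, e2, h0, h1, rfl⟩, h2, rfl⟩ := hp
            obtain rfl : e1 = 0 := h0
            have := P.comp_mem h1 h2
            simpa [opMap] using this
          | cons p g' => simp at h
    · rw [P.opMap_eq_zero p h]
      exact Submodule.zero_mem _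
  m_rel {X Y} p := by
    by_cases h : p.length = 3
    · cases p with
      | nil => simp at h
      | cons p f =>
      cases p with
      | nil => simp at h
      | cons p g =>
      cases p with
      | nil => simp at h
      | cons p k =>
      cases p with
      | cons p l => simp at h
      | nil =>
        have s1 : sgn K 1 = -1 := by simp [sgn]
        have s2 : sgn K 2 = 1 := by simp [sgn, Int.negOnePow_even]
        simp [coderSum, Chain.sumSplit, opMap, s1, s2, twistChain_cons, twistChain_nil,
          twist_zero, P.assoc]
    · refine Chain.sumSplit_eq_zero _ _ fun Z a bc h1 => Chain.sumSplit_eq_zero _ _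
        fun W b c h2 => ?_
      by_cases hb : b.length = 2
      · refine (congrArg _ (P.opMap_eq_zero _ ?_)).trans (smul_zero _)
        rw [Chain.length_append, Chain.length_cons, length_twistChain]
        rw [← h1, ← h2, Chain.length_append, Chain.length_append] at h
        omega
      · refine (congrArg _ ?_).trans (smul_zero _)
        change P.opMap ((a.cons (P.opMap b)).append _) = 0
        rw [P.opMap_eq_zero b hb]
        exact ((P.opMap_multilinear _ _) _ _ a _).map_zero
  one := P.one
  one_degree := P.one_mem
  m_one _ := rfl
  m_comp_one f := P.one_comp f
  m_one_comp f := P.comp_one f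
  m_insert_one a c h := P.opMap_eq_zero _ (by
    rw [Chain.length_append, Chain.length_cons]; omega)

variable {P} {Q : GradedCat K} {o : P.Ob → Q.Ob}

/-- The collection with `F¹ f = f₁ f`, `F² (g, f) = f₂ f g`, and `Fⁱ = 0` for `i > 2`. -/
def pairMap (f₁ : ∀ {X Y : P.Ob}, P.Hom X Y →ₗ[K] Q.Hom (o X) (o Y))
    (f₂ : ∀ {X Y Z : P.Ob}, P.Hom X Y →ₗ[K] P.Hom Y Z →ₗ[K] Q.Hom (o X) (o Z)) {X Y : P.Ob} :
    Chain P.Hom X Y → Q.Hom (o X) (o Y)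
  | .cons (.nil _) f => f₁ f
  | .cons (.cons (.nil _) f) g => f₂ f g
  | _ => 0

variable (f₁ : ∀ {X Y : P.Ob}, P.Hom X Y →ₗ[K] Q.Hom (o X) (o Y))
    (f₂ : ∀ {X Y Z : P.Ob}, P.Hom X Y →ₗ[K] P.Hom Y Z →ₗ[K] Q.Hom (o X) (o Z))

lemma pairMap_eq_zero {X Y : P.Ob} (p : Chain P.Hom X Y) (h1 : p.length ≠ 1) (h2 : p.length ≠ 2) :
    pairMap f₁ f₂ p = 0 := by
  cases p with
  | nil => rfl
  | cons p f =>
    cases p with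
    | nil => exact absurd rfl h1
    | cons p g =>
      cases p with
      | nil => exact absurd rfl h2
      | cons p h => rfl

lemma pairMap_multilinear (X Y : P.Ob) :
    Chain.Multilinear K (fun p : Chain P.Hom X Y => pairMap f₁ f₂ p) := by
  intro S T a c
  by_cases h : a.length + c.length ≤ 1
  · cases c with
    | nil =>
      cases a with
      | nil => exact f₁.isLinear
      | cons a g =>
        cases a with
        | nil => exact (f₂ g).isLinear
        | cons a g' => simp at h
    | cons c f =>
      cases c with
      | nil =>
        cases a with
        | nil => exact (f₂.flip f).isLinear
        | cons a g' => simp at h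
      | cons c g => simp at h; omega
  · have : ∀ f : P.Hom S T, pairMap f₁ f₂ ((Chain.cons a f).append c) = 0 := fun f =>
      pairMap_eq_zero _ _ _ (by rw [Chain.length_append, Chain.length_cons]; omega)
        (by rw [Chain.length_append, Chain.length_cons]; omega)
    simp only [this]
    exact Chain.isLinearMap_zero

lemma twistChain_eq_self (h0 : ∀ (X Y : P.Ob) (f : P.Hom X Y), f ∈ P.gr X Y 0) (k : ℤ)
    {X Y : P.Ob} (p : Chain P.Hom X Y) : P.twistChain k p = p := by
  induction p with
  | nil => rfl
  | cons p f ih => rw [twistChain_cons, ih, P.twist_of_mem k (h0 _ _ f), mul_zero, sgn_zero, one_smul]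

lemma deg_eq_zero (h0 : ∀ (X Y : P.Ob) (f : P.Hom X Y), f ∈ P.gr X Y 0) {X Y : P.Ob}
    (f : P.Hom X Y) (d : ℤ) (hf : f ∈ P.gr X Y d) : d = 0 ∨ f = 0 := by
  by_contra! h
  have hi := (P.internal X Y).submodule_iSupIndep
  have := hi.pairwiseDisjoint h.1
  exact h.2 ((Submodule.disjoint_def.1 this) f hf (h0 _ _ f))

lemma pairMap_degree (h0 : ∀ (X Y : P.Ob) (f : P.Hom X Y), f ∈ P.gr X Y 0)
    (d₁ : ∀ {X Y : P.Ob} (f : P.Hom X Y), f₁ f ∈ Q.gr _ _ 0)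
    (d₂ : ∀ {X Y Z : P.Ob} (f : P.Hom X Y) (g : P.Hom Y Z), f₂ f g ∈ Q.gr _ _ (-1))
    {X Y : P.Ob} (p : Chain P.Hom X Y) (d : ℤ) (hp : P.HasDegree p d) :
    pairMap f₁ f₂ p ∈ Q.gr (o X) (o Y) (d + 1 - p.length) := by
  cases p with
  | nil => exact Submodule.zero_mem _
  | cons p f =>
  obtain ⟨e, e', h1, h2, rfl⟩ := hp
  cases p with
  | nil =>
    obtain rfl : e = 0 := h1
    rcases deg_eq_zero h0 f e' h2 with rfl | rfl
    · simpa [pairMap] using d₁ f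
    · simp [pairMap]
  | cons p g =>
  obtain ⟨e1, e2, h3, h4, rfl⟩ := h1
  cases p with
  | nil =>
    obtain rfl : e1 = 0 := h3
    rcases deg_eq_zero h0 f e' h2 with rfl | rfl
    · rcases deg_eq_zero h0 g e2 h4 with rfl | rfl
      · simpa [pairMap] using d₂ g f
      · simp [pairMap]
    · simp [pairMap]
  | cons p k => exact Submodule.zero_mem _
lemma pairMap_rel (h0 : ∀ (X Y : P.Ob) (f : P.Hom X Y), f ∈ P.gr X Y 0)
    (r₂ : ∀ {X Y Z : P.Ob} (f : P.Hom X Y) (g : P.Hom Y Z),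
      f₁ (P.comp f g) = Q.comp (f₁ f) (f₁ g))
    (r₃ : ∀ {X Y Z W : P.Ob} (f : P.Hom X Y) (g : P.Hom Y Z) (h : P.Hom Z W),
      f₂ (P.comp f g) h + Q.comp (f₂ f g) (f₁ h) = f₂ f (P.comp g h) + Q.comp (f₁ f) (f₂ g h))
    (r₄ : ∀ {X Y Z W V : P.Ob} (f : P.Hom X Y) (g : P.Hom Y Z) (h : P.Hom Z W) (k : P.Hom W V),
      Q.comp (f₂ f g) (f₂ h k) = 0)
    {X Y : P.Ob} (p : Chain P.Hom X Y) :
    P.coderSum (fun q => P.opMap q) (fun q => pairMap f₁ f₂ q) p =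
      blockSum (Q := P.toGradedQuiver) (R := Q.toGradedQuiver)
        (fun q => pairMap f₁ f₂ q) (fun q => Q.opMap q) p := by
  have s1 : sgn K 1 = -1 := by simp [sgn]
  have s1' : sgn K (-1) = -1 := by simp [sgn]
  have s2 : sgn K 2 = 1 := by simp [sgn, Int.negOnePow_even]
  have s2' : sgn K (-2) = 1 := by simp [sgn, Int.negOnePow_even]
  by_cases hl : p.length ≤ 3
  · cases p with
    | nil => simp [coderSum, blockSum, Chain.sumSplit, Chain.sumBlocks, pairMap, opMap, blockMap,
        twistChain_nil]
    | cons p f =>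
    cases p with
    | nil => simp [coderSum, blockSum, Chain.sumSplit, Chain.sumBlocks, pairMap, opMap, blockMap,
        twistChain_nil, Chain.extendLast, twistChain_eq_self h0]
    | cons p g =>
    cases p with
    | nil => simp [coderSum, blockSum, Chain.sumSplit, Chain.sumBlocks, pairMap, opMap, blockMap,
        twistChain_nil, Chain.extendLast, twistChain_eq_self h0, blockSign, blockShift, sgn_zero,
        r₂]
    | cons p k =>
    cases p with
    | nil =>
      simp [coderSum, blockSum, Chain.sumSplit, Chain.sumBlocks, pairMap, opMap, blockMap,
        twistChain_nil, Chain.extendLast, twistChain_eq_self h0, blockSign, blockShift, sgn_zero,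
        s1, s2, s1', s2']
      have h3 := r₃ k g f
      rw [← sub_eq_zero] at h3 ⊢
      rw [← h3]
      abel
    | cons p l => simp at hl; omega
  · have hL : P.coderSum (fun q => P.opMap q) (fun q => pairMap f₁ f₂ q) p = 0 := by
      refine Chain.sumSplit_eq_zero _ _ fun Z a bc h1 => Chain.sumSplit_eq_zero _ _
        fun W b c h2 => ?_
      by_cases hb : b.length = 2
      · rw [← h1, ← h2, Chain.length_append, Chain.length_append] at hl
        refine (congrArg _ (pairMap_eq_zero f₁ f₂ _ ?_ ?_)).trans (smul_zero _) <;>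
        · rw [Chain.length_append, Chain.length_cons, length_twistChain]
          omega
      · refine (congrArg _ ?_).trans (smul_zero _)
        change pairMap f₁ f₂ ((a.cons (P.opMap b)).append _) = 0
        rw [P.opMap_eq_zero b hb]
        exact ((pairMap_multilinear f₁ f₂ _ _) _ _ a _).map_zero
    rw [hL, blockSum, sumBlocks_congr' (Ψ := fun _ => 0), Chain.sumBlocks_zero]
    intro D hD
    rw [← hD] at hl
    cases D with
    | nil => simp [blockMap, opMap]
    | cons D b =>
    cases D with
    | nil => simp [blockMap, opMap]
    | cons D b' =>
    cases D with
    | cons D b'' => simp [blockMap, opMap]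
    | nil =>
      simp only [blockMap, opMap, twistChain_eq_self h0]
      simp only [blockLength] at hl
      have e0 : sgn K (blockSign (((Chain.nil X).cons b').cons b)) •
          Q.comp (pairMap f₁ f₂ b') (pairMap f₁ f₂ b) = 0 := by
        by_cases e1 : b.length = 2 ∧ b'.length = 2
        · obtain ⟨e1, e2⟩ := e1
          cases b with
          | nil => simp at e1
          | cons b x =>
          cases b with
          | nil => simp at e1
          | cons b y =>
          cases b with
          | cons b z => simp at e1
          | nil =>
          cases b' with
          | nil => simp at e2
          | cons b' x' =>
          cases b' with
          | nil => simp at e2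
          | cons b' y' =>
          cases b' with
          | cons b' z' => simp at e2
          | nil => simp [pairMap, r₄]
        · by_cases e2 : b.length ≤ 2
          · rw [pairMap_eq_zero f₁ f₂ b' (by omega) (by omega)]
            simp
          · rw [pairMap_eq_zero f₁ f₂ b (by omega) (by omega)]
            simp
      exact e0

lemma pairMap_insert_one (u₁ : ∀ {X Y : P.Ob} (g : P.Hom X Y), f₂ (P.one X) g = 0)
    (u₂ : ∀ {X Y : P.Ob} (f : P.Hom X Y), f₂ f (P.one Y) = 0) {X Y Z : P.Ob}
    (a : Chain P.Hom X Y) (q : Chain P.Hom Y Z) (h : 1 < a.length + 1 + q.length) :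
    pairMap f₁ f₂ ((a.cons (P.one Y)).append q) = 0 := by
  by_cases hl : a.length + q.length = 1
  · cases q with
    | nil =>
      cases a with
      | nil => simp at hl
      | cons a f =>
        cases a with
        | nil => exact u₂ f
        | cons a f' => simp at hl
    | cons q f =>
      cases q with
      | cons q f' => simp at hl; omega
      | nil =>
        cases a with
        | cons a g => simp at hl
        | nil => exact u₁ f
  · refine pairMap_eq_zero _ _ _ ?_ ?_ <;>
    · rw [Chain.length_append, Chain.length_cons]
      omega

/-- The `A_∞` functor with `F¹ f = f₁ f`, `F² (g, f) = f₂ f g`, and `Fⁱ = 0` for `i > 2`, from a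
graded category sitting in degree `0`. -/
def pairFunctor (h0 : ∀ (X Y : P.Ob) (f : P.Hom X Y), f ∈ P.gr X Y 0)
    (d₁ : ∀ {X Y : P.Ob} (f : P.Hom X Y), f₁ f ∈ Q.gr _ _ 0)
    (d₂ : ∀ {X Y Z : P.Ob} (f : P.Hom X Y) (g : P.Hom Y Z), f₂ f g ∈ Q.gr _ _ (-1))
    (r₂ : ∀ {X Y Z : P.Ob} (f : P.Hom X Y) (g : P.Hom Y Z),
      f₁ (P.comp f g) = Q.comp (f₁ f) (f₁ g))
    (r₃ : ∀ {X Y Z W : P.Ob} (f : P.Hom X Y) (g : P.Hom Y Z) (h : P.Hom Z W),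
      f₂ (P.comp f g) h + Q.comp (f₂ f g) (f₁ h) = f₂ f (P.comp g h) + Q.comp (f₁ f) (f₂ g h))
    (r₄ : ∀ {X Y Z W V : P.Ob} (f : P.Hom X Y) (g : P.Hom Y Z) (h : P.Hom Z W) (k : P.Hom W V),
      Q.comp (f₂ f g) (f₂ h k) = 0) :
    NUAInfFunctor P.toACat.toNUAInfCat Q.toACat.toNUAInfCat where
  obj := o
  map p := pairMap (P := P) f₁ f₂ p
  map_nil _ := rfl
  map_linear := pairMap_multilinear f₁ f₂
  map_degree := pairMap_degree f₁ f₂ h0 d₁ d₂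
  map_rel := pairMap_rel f₁ f₂ h0 r₂ r₃ r₄

end GradedCat

/-! ### The example -/

section dualNumbers

open GradedQuiver TrivSqZeroExt

/-- A graded `K`-algebra, as a graded category with one object. -/
def GradedCat.ofAlgebra {K : Type u} [Field K] (R : Type u) [Ring R] [Algebra K R]
    (gr : ℤ → Submodule K R) (h : DirectSum.IsInternal gr) (h₁ : (1 : R) ∈ gr 0)
    (h₂ : ∀ {d e : ℤ} {x y : R}, x ∈ gr d → y ∈ gr e → y * x ∈ gr (d + e)) : GradedCat K where
  Ob := PUnit
  Hom _ _ := R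
  gr _ _ := gr
  internal _ _ := h
  comp := (LinearMap.mul K R).flip
  one _ := (1 : R)
  comp_mem := h₂
  one_mem _ := h₁
  assoc f g h := (mul_assoc (h : R) g f).symm
  one_comp f := mul_one (f : R)
  comp_one f := one_mul (f : R)

variable (K : Type u) [Field K]

/-- Recognizing internal gradings through projections. -/
lemma isInternal_of_proj {R : Type u} [AddCommGroup R] [Module K R]
    (gr : ℤ → Submodule K R) (π : ℤ → R →ₗ[K] R)
    (h1 : ∀ d x, π d x ∈ gr d) (h2 : ∀ d, ∀ x ∈ gr d, π d x = x)
    (h3 : ∀ d e, d ≠ e → ∀ x ∈ gr e, π d x = 0) (s : Finset ℤ) (h4 : ∀ x, ∑ d ∈ s, π d x = x) :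
    DirectSum.IsInternal gr := by
  constructor
  · intro v w hvw
    have key : ∀ (d : ℤ) (v : DirectSum ℤ fun d => gr d),
        π d (DirectSum.coeAddMonoidHom gr v) = v d := by
      intro d v
      induction v using DirectSum.induction_on with
      | zero => simp
      | of e x =>
        rw [DirectSum.coeAddMonoidHom_of]
        by_cases h : d = e
        · subst h; rw [h2 d _ x.2, DirectSum.of_eq_same]
        · rw [h3 d e h _ x.2, DirectSum.of_eq_of_ne _ _ _ h]; rfl
      | add v w hv hw => rw [map_add, map_add, hv, hw]; rfl
    ext d
    rw [← key, ← key, hvw]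
  · intro x
    refine ⟨∑ d ∈ s, DirectSum.of (fun d => gr d) d ⟨π d x, h1 d x⟩, ?_⟩
    rw [map_sum]
    simp only [DirectSum.coeAddMonoidHom_of]
    exact h4 x

/-- The grading concentrated in degree `0`. -/
def grZero (R : Type u) [AddCommGroup R] [Module K R] (d : ℤ) : Submodule K R :=
  if d = 0 then ⊤ else ⊥

lemma grZero_internal (R : Type u) [AddCommGroup R] [Module K R] :
    DirectSum.IsInternal (grZero K R) := by
  refine isInternal_of_proj K _ (fun d => if d = 0 then LinearMap.id else 0) ?_ ?_ ?_ {0} ?_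
  · intro d x; by_cases h : d = 0 <;> simp [h, grZero]
  · intro d x hx; by_cases h : d = 0
    · simp [h]
    · simp [h, grZero] at hx; simp [hx]
  · intro d e h x hx
    by_cases h0 : d = 0
    · subst h0; rw [grZero, if_neg (Ne.symm h)] at hx; simp [(Submodule.mem_bot K).1 hx]
    · simp [h0]
  · intro x; simp

/-- The graded algebra `K[ε₁, ε₂]`, with `εᵢ εⱼ = 0` for all `i, j` and with `ε₁`, `ε₂` of degree
`0`. As an algebra it is the square-zero extension `K ⊕ (K ε₁ ⊕ K ε₂)`. -/
def twoEps : GradedCat K :=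
  .ofAlgebra (TrivSqZeroExt K (K × K)) (grZero K _) (grZero_internal K _) (by simp [grZero])
    (by
      intro d e x y hx hy
      by_cases hd : d = 0
      · by_cases he : e = 0
        · simp [hd, he, grZero]
        · rw [grZero, if_neg he, Submodule.mem_bot] at hy
          subst hy; rw [zero_mul]; exact Submodule.zero_mem _
      · rw [grZero, if_neg hd, Submodule.mem_bot] at hx
        subst hx; rw [mul_zero]; exact Submodule.zero_mem _)

/-- The grading of the dual numbers `K[ε]`, where `ε² = 0`, with `ε` of degree `-1`. -/
def grEps (d : ℤ) : Submodule K (DualNumber K) :=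
  if d = 0 then LinearMap.range (inlAlgHom K K K).toLinearMap
  else if d = -1 then LinearMap.range (inrHom K K) else ⊥

lemma mem_grEps (d : ℤ) (x : DualNumber K) :
    x ∈ grEps K d ↔ (d ≠ 0 → x.fst = 0) ∧ (d ≠ -1 → x.snd = 0) := by
  unfold grEps
  by_cases h : d = 0
  · subst h
    simp only [if_true, LinearMap.mem_range]
    constructor
    · rintro ⟨y, rfl⟩; simp
    · rintro ⟨-, h⟩
      exact ⟨x.fst, TrivSqZeroExt.ext (by simp) (by simp [h])⟩
  · by_cases h' : d = -1
    · subst h'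
      rw [if_neg (by decide), if_pos rfl, LinearMap.mem_range]
      constructor
      · rintro ⟨y, rfl⟩; simp
      · rintro ⟨h, -⟩
        exact ⟨x.snd, TrivSqZeroExt.ext (by simp [h]) (by simp)⟩
    · rw [if_neg h, if_neg h', Submodule.mem_bot]
      constructor
      · rintro rfl; simp
      · rintro ⟨h1, h2⟩
        exact TrivSqZeroExt.ext (h1 h) (h2 h')

lemma grEps_internal : DirectSum.IsInternal (grEps K) := by
  refine isInternal_of_proj K _ (fun d => if d = 0 then
      (inlAlgHom K K K).toLinearMap ∘ₗ (fstHom K K K).toLinearMap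
    else if d = -1 then inrHom K K ∘ₗ sndHom K K else 0) ?_ ?_ ?_ {0, -1} ?_
  · intro d x
    rw [mem_grEps]
    by_cases h : d = 0
    · simp [h]
    · by_cases h' : d = -1 <;> simp [h, h']
  · intro d x hx
    rw [mem_grEps] at hx
    by_cases h : d = 0
    · subst h
      exact TrivSqZeroExt.ext (by simp) (by simp [hx.2 (by decide)])
    · by_cases h' : d = -1
      · subst h'
        exact TrivSqZeroExt.ext (by simp [hx.1 (by decide)]) (by simp)
      · exact TrivSqZeroExt.ext (by simp [h, h', hx.1 h]) (by simp [h, h', hx.2 h'])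
  · intro d e h x hx
    rw [mem_grEps] at hx
    by_cases hd : d = 0
    · subst hd
      exact TrivSqZeroExt.ext (by simp [hx.1 (Ne.symm h)]) (by simp)
    · by_cases hd' : d = -1
      · subst hd'
        exact TrivSqZeroExt.ext (by simp) (by simp [hx.2 (Ne.symm h)])
      · simp [hd, hd']
  · intro x
    exact TrivSqZeroExt.ext (by simp) (by simp)

/-- The graded algebra `K[ε]`, with `ε² = 0` and with `ε` of degree `-1`. -/
def eps : GradedCat K :=
  .ofAlgebra (DualNumber K) (grEps K) (grEps_internal K) (by simp [mem_grEps])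
    (by
      intro d e x y hx hy
      rw [mem_grEps] at hx hy ⊢
      simp only [fst_mul, snd_mul, smul_eq_mul, MulOpposite.smul_eq_mul_unop,
        MulOpposite.unop_op]
      constructor
      · intro h
        by_cases hd : d = 0
        · rw [hy.1 (by omega), zero_mul]
        · rw [hx.1 hd, mul_zero]
      · intro h
        by_cases hd : d = 0
        · rw [hy.2 (by omega), hx.2 (by omega)]; simp
        · rw [hx.1 hd]
          by_cases hd' : d = -1
          · rw [hy.1 (by omega)]; simp
          · rw [hx.2 hd']; simp)

/-- The algebra map `K[ε₁, ε₂] → K[ε]` with `εᵢ ↦ 0`. -/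
def epsLin : TrivSqZeroExt K (K × K) →ₗ[K] DualNumber K :=
  (inlAlgHom K K K).toLinearMap ∘ₗ (fstHom K K (K × K)).toLinearMap

/-- The bilinear map `(f, g) ↦ c g₁ f₂ ε`, where `x = x₀ + x₁ ε₁ + x₂ ε₂` for `x` in
`K[ε₁, ε₂]`. -/
def epsBilin (c : K) :
    TrivSqZeroExt K (K × K) →ₗ[K] TrivSqZeroExt K (K × K) →ₗ[K] DualNumber K :=
  LinearMap.mk₂ K (fun f g => inr (c * (g.snd.1 * f.snd.2)))
    (by intros; ext <;> simp; ring) (by intros; ext <;> simp; ring)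
    (by intros; ext <;> simp; ring) (by intros; ext <;> simp; ring)

lemma epsLin_apply (f : TrivSqZeroExt K (K × K)) : epsLin K f = inl f.fst := rfl

lemma epsBilin_apply (c : K) (f g : TrivSqZeroExt K (K × K)) :
    epsBilin K c f g = inr (c * (g.snd.1 * f.snd.2)) := rfl

lemma epsLin_mem (f : TrivSqZeroExt K (K × K)) : epsLin K f ∈ grEps K 0 := by
  rw [mem_grEps]; simp [epsLin_apply]

lemma epsBilin_mem (c : K) (f g : TrivSqZeroExt K (K × K)) : epsBilin K c f g ∈ grEps K (-1) := by
  rw [mem_grEps]; simp [epsBilin_apply]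

lemma epsLin_mul (f g : TrivSqZeroExt K (K × K)) : epsLin K (g * f) = epsLin K g * epsLin K f := by
  simp [epsLin_apply]

lemma epsBilin_rel (c : K) (f g h : TrivSqZeroExt K (K × K)) :
    epsBilin K c (g * f) h + epsLin K h * epsBilin K c f g =
      epsBilin K c f (h * g) + epsBilin K c g h * epsLin K f := by
  simp only [epsLin_apply, epsBilin_apply]
  ext
  · simp
  · simp
    ring

lemma epsBilin_mul (c : K) (f g h k : TrivSqZeroExt K (K × K)) :
    epsBilin K c h k * epsBilin K c f g = 0 := by
  simp [epsBilin_apply]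

lemma epsBilin_one_left (c : K) (g : TrivSqZeroExt K (K × K)) : epsBilin K c 1 g = 0 := by
  simp [epsBilin_apply]

lemma epsBilin_one_right (c : K) (f : TrivSqZeroExt K (K × K)) : epsBilin K c f 1 = 0 := by
  simp [epsBilin_apply]

lemma mem_grZero {R : Type u} [AddCommGroup R] [Module K R] (x : R) : x ∈ grZero K R 0 := by
  rw [grZero, if_pos rfl]; trivial

/-- The `A_∞` functor `F : K[ε₁, ε₂] → K[ε]` with `F¹ 1 = 1`, `F¹ ε₁ = F¹ ε₂ = 0`,
`F² (ε₁, ε₂) = c ε`, `F² (εᵢ, εⱼ) = 0` if `(i, j) ≠ (1, 2)`, `F² (1, x) = F² (x, 1) = 0`, and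
`Fⁱ = 0` for `i > 2`. -/
def epsFunctor₀ (c : K) :
    NUAInfFunctor (twoEps K).toACat.toNUAInfCat (eps K).toACat.toNUAInfCat :=
  GradedCat.pairFunctor (P := twoEps K) (Q := eps K) (o := fun _ => PUnit.unit)
    (epsLin K) (epsBilin K c) (fun _ _ f => mem_grZero K (R := TrivSqZeroExt K (K × K)) f)
    (epsLin_mem K) (epsBilin_mem K c) (epsLin_mul K) (epsBilin_rel K c) (epsBilin_mul K c)

lemma epsFunctor₀_strictlyUnital (c : K) : (epsFunctor₀ K c).StrictlyUnital where
  map_one X := (by simp [epsLin_apply] : epsLin K 1 = 1)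
  map_insert_one a q h :=
    GradedCat.pairMap_insert_one (P := twoEps K) (Q := eps K) (o := fun _ => PUnit.unit)
      (epsLin K) (epsBilin K c) (epsBilin_one_left K c) (epsBilin_one_right K c) a q h

/-- The strictly unital `A_∞` functor `epsFunctor₀ K c`, as a morphism. For `c = 0` it is the strict
functor `F₁` with `F₁ εᵢ = 0`, and for `c = 1` it is the functor `F₂` with `F₂¹ = F₁¹`,
`F₂² (ε₁, ε₂) = ε`. -/
def epsFunctor (c : K) : (twoEps K).toACat ⟶ (eps K).toACat :=
  ⟨epsFunctor₀ K c, epsFunctor₀_strictlyUnital K c⟩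

end dualNumbers

/-! Let `S s t` stand for the strict endofunctor ε₁ ↦ s ε₁, ε₂ ↦ t ε₂ of K[ε₁, ε₂], and `F c` for
the functor to K[ε] with quadratic part F²(ε₁, ε₂) = c ε, so that the pair in question is `F 0`, `F
1`. The obstruction is that the condition of being equalized is quadratic in the linear part of a
functor: it confines that linear part to a cone such as {x₁ x₂ = 0} and not to a linear subspace,
while the arrows of an equalizer would form a vector space.

Suppose that e : E → K[ε₁, ε₂] equalizes `F 0` and `F 1`. On two composable arrows the composite has
quadratic part F²(e¹ y, e¹ x) + F¹(e²(y, x)). Since the two functors have the same F¹, equality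
leaves F₂²(e¹ y, e¹ x) = 0: the ε₁-coefficient of e¹ y times the ε₂-coefficient of e¹ x is zero
(`epsBilin_eq_zero_of_comp_eq`).

On the other hand `S s t` followed by `F c` is `F (c s t)` (`scaleFunctor₀_comp_epsFunctor₀`), so `S
1 0` and `S 0 1` both equalize the pair. If e is an equalizer, they factor through it as l₁ and l₂,
and then e¹ takes l₁¹(ε₁) to ε₁ and l₂¹(ε₂) to ε₂. If these two arrows of E can be composed, the
product of coefficients above is 1 · 1, a contradiction.

Composability is the one delicate point, because E may have many objects over the single object of
K[ε₁, ε₂]. Both `S 1 0` and `S 0 1` restrict along `S 0 0` to `S 0 0`. As an equalizer is a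
monomorphism, l₁ and l₂ agree after precomposition with `S 0 0`, hence have the same value on the
unique object.

The contradiction, `not_exists_equalizing_factorization`, uses no units in E, so a single argument
serves the strictly unital and the cohomologically unital category. A model category has finite
limits, in particular equalizers, so neither category carries a model structure. -/

/-! ### Block sums for strict functors -/

namespace Chain

variable {Ob : Type u} {V : Ob → Ob → Type u} {Ob' : Type u} {W : Ob' → Ob' → Type u}
  {o : Ob → Ob'}

/-- Apply a map of quivers to every arrow of a chain. -/
def mapArrows (g : ∀ {X Y : Ob}, V X Y → W (o X) (o Y)) {X Y : Ob} :
    Chain V X Y → Chain W (o X) (o Y)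
  | nil X => nil (o X)
  | cons p f => (mapArrows g p).cons (g f)

lemma length_mapArrows (g : ∀ {X Y : Ob}, V X Y → W (o X) (o Y)) {X Y : Ob}
    (p : Chain V X Y) : (mapArrows (o := o) (fun f => g f) p).length = p.length := by
  induction p with
  | nil => rfl
  | cons p f ih => simp [mapArrows, ih]

variable {K : Type u} [Field K]
  [∀ X Y, AddCommGroup (V X Y)] [∀ X Y, Module K (V X Y)]
  [∀ X Y, AddCommGroup (W X Y)] [∀ X Y, Module K (W X Y)]
  {M : Type u} [AddCommGroup M] [Module K M]

/-- If `F` vanishes on chains of length at least two, only the decomposition into blocks of length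
one contributes to the sum over block decompositions. -/
lemma bs_of_strict {F : ∀ {X Y : Ob}, Chain V X Y → W (o X) (o Y)}
    (hF : ∀ {X Y : Ob} (p : Chain V X Y), 1 < p.length → F p = 0) {X Y : Ob}
    {φ : Chain W (o X) (o Y) → M} (hφ : Multilinear K φ) (p : Chain V X Y) :
    bs F φ p = φ (mapArrows (fun {X _} f => F ((nil X).cons f)) p) := by
  induction p with
  | nil => rfl
  | cons p f ih =>
    rw [bs_cons]
    -- The leftmost block is `f` preceded by a final piece `c` of `p`. Only empty `c` survives, and
    -- the remaining sum is the one over `p` with the value on `f` held fixed as last entry.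
    refine (sumSplit_right_nil p _ fun Z a c hc => ?_).trans (ih (hφ.init _))
    -- A nonempty `c` makes this block have length at least two, so `F` vanishes on it and
    -- multilinearity of `φ` kills the term.
    rw [hF (c.cons f) (by rw [length_cons]; omega)]
    simp only [(hφ.last _).map_zero, bs_zero]

end Chain

/-! ### The quadratic part of a composite -/

namespace NUAInfFunctor

open GradedQuiver

variable {K : Type u} [Field K]

/-- A chain of two arrows has two block decompositions: two blocks of length one, or one block of
length two. Neither contributes a sign. A block of length one has shift 1 - 1 = 0, and the single
block of length two has no earlier block whose shift it could pair with, so all exponents and all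
Koszul twists are zero. This is the only part of the composition formula, beyond the linear one,
needed to see the obstruction. -/
lemma comp_map_two {A B C : NUAInfCat K} (F : NUAInfFunctor A B) (G : NUAInfFunctor B C)
    {X Y Z : A.Ob} (f : A.Hom X Y) (g : A.Hom Y Z) :
    (comp F G).map (((Chain.nil X).cons f).cons g) =
      G.map (((Chain.nil _).cons (F.map ((Chain.nil X).cons f))).cons
        (F.map ((Chain.nil Y).cons g))) +
      G.map ((Chain.nil _).cons (F.map (((Chain.nil X).cons f).cons g))) := by
  change blockSum F.map (fun q => G.map q) _ = _
  simp [blockSum, Chain.sumBlocks, Chain.extendLast, blockMap, twistChain_nil, twistChain_cons,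
    blockSign, blockShift, sgn_zero, twist_zero]

end NUAInfFunctor

/-! ### Composition with strict functors in degree zero -/

section degreeZero

open GradedQuiver

variable {K : Type u} [Field K]

/-- Koszul twists act trivially on arrows of degree 0, so `ramp` is the identity and the passage to
shifted arrows retains only the sign that depends on the length of the chain. -/
lemma GradedQuiver.hat_eq_smul {Q : GradedQuiver K}
    (h0 : ∀ (X Y : Q.Ob) (f : Q.Hom X Y), f ∈ Q.gr X Y 0)
    {M : Type u} [AddCommGroup M] [Module K M] {X Y : Q.Ob} (φ : Chain Q.Hom X Y → M)
    (p : Chain Q.Hom X Y) : hat φ p = sgn K (tri p.length) • φ p := by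
  have : ramp p = p := by
    -- The type of `φ` involves the endpoint of `p`; without clearing it, the induction hypothesis
    -- would be quantified over `φ` as well.
    clear φ
    induction p with
    | nil => rfl
    | cons p f ih => rw [ramp, ih, Q.twist_of_mem _ (h0 _ _ f), mul_zero, sgn_zero, one_smul]
  rw [hat, this]

/-- Precomposition with a strict functor between `A_∞` categories sitting in degree `0`. -/
lemma NUAInfFunctor.comp_map_of_strict {A B C : NUAInfCat K}
    (hA : ∀ (X Y : A.Ob) (f : A.Hom X Y), f ∈ A.gr X Y 0)
    (hB : ∀ (X Y : B.Ob) (f : B.Hom X Y), f ∈ B.gr X Y 0) (F : NUAInfFunctor A B)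
    (hF : ∀ {X Y : A.Ob} (p : Chain A.Hom X Y), 1 < p.length → F.map p = 0)
    (G : NUAInfFunctor B C) {X Y : A.Ob} (p : Chain A.Hom X Y) :
    (F.comp G).map p =
      G.map (Chain.mapArrows (fun {X _} f => F.map ((Chain.nil X).cons f)) p) := by
  change blockSum F.map (fun q => G.map q) p = _
  rw [comp_eq, hat_eq_smul hA]
  refine (congrArg _ (Chain.bs_of_strict (K := K) (o := F.obj)
    (F := fun q => hat (fun q => F.map q) q) (fun {X Y} p hp => ?_)
    (hat_multilinear (G.map_linear (F.obj X) (F.obj Y))) p)).trans ?_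
  -- Strictness survives the passage to shifted arrows, since the latter only multiplies values by a
  -- sign here.
  · rw [hat_eq_smul hA, hF p hp, smul_zero]
  · simp only [hat_one]
    -- One length sign comes from the source chain and one from its image. A strict functor acts
    -- arrow by arrow and keeps the length, so the two signs are equal and their product is 1.
    rw [hat_eq_smul hB, smul_smul, Chain.length_mapArrows, sgn_mul_self, one_smul]

end degreeZero

/-! ### The scaling endofunctors of K[ε₁, ε₂] -/

section dualNumbers

open GradedQuiver TrivSqZeroExt

variable (K : Type u) [Field K]

/-- The algebra endomorphism `ε₁ ↦ s ε₁`, `ε₂ ↦ t ε₂` of `K[ε₁, ε₂]`, as a linear map. -/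
def scaleLin (s t : K) : TrivSqZeroExt K (K × K) →ₗ[K] TrivSqZeroExt K (K × K) where
  toFun f := inl f.fst + inr (s * f.snd.1, t * f.snd.2)
  map_add' f g := by ext <;> simp <;> ring
  map_smul' c f := by ext <;> simp <;> ring

lemma scaleLin_apply (s t : K) (f : TrivSqZeroExt K (K × K)) :
    scaleLin K s t f = inl f.fst + inr (s * f.snd.1, t * f.snd.2) := rfl

/-- The square-zero ideal makes every linear map of the span of ε₁, ε₂ extend to an algebra map;
this is the diagonal case. -/
lemma scaleLin_mul (s t : K) (f g : TrivSqZeroExt K (K × K)) :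
    scaleLin K s t (g * f) = scaleLin K s t g * scaleLin K s t f := by
  ext <;> simp [scaleLin_apply] <;> ring

/-- Scaling by (0, 0) projects onto the constants, which every scaling fixes. -/
lemma scaleLin_zero_apply (s t : K) (f : TrivSqZeroExt K (K × K)) :
    scaleLin K s t (scaleLin K 0 0 f) = scaleLin K 0 0 f := by
  simp [scaleLin_apply]

lemma epsLin_scaleLin (s t : K) (f : TrivSqZeroExt K (K × K)) :
    epsLin K (scaleLin K s t f) = epsLin K f := by
  simp [epsLin_apply, scaleLin_apply]

/-- The pairing reads the ε₁-coefficient of the later arrow and the ε₂-coefficient of the earlier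
one; the first contributes the factor s and the second the factor t. -/
lemma epsBilin_scaleLin (s t c : K) (f g : TrivSqZeroExt K (K × K)) :
    epsBilin K c (scaleLin K s t f) (scaleLin K s t g) = epsBilin K (c * (s * t)) f g := by
  rw [epsBilin_apply, epsBilin_apply]
  congr 1
  simp [scaleLin_apply]
  ring

lemma epsBilin_zero (f g : TrivSqZeroExt K (K × K)) : epsBilin K 0 f g = 0 := by
  simp [epsBilin_apply]

/-- The zero pairing on `K[ε₁, ε₂]`. -/
def zeroBilin :
    TrivSqZeroExt K (K × K) →ₗ[K] TrivSqZeroExt K (K × K) →ₗ[K] TrivSqZeroExt K (K × K) := 0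

/-- The strict `A_∞` endofunctor `ε₁ ↦ s ε₁`, `ε₂ ↦ t ε₂` of `K[ε₁, ε₂]`. -/
def scaleFunctor₀ (s t : K) :
    NUAInfFunctor (twoEps K).toACat.toNUAInfCat (twoEps K).toACat.toNUAInfCat :=
  GradedCat.pairFunctor (P := twoEps K) (Q := twoEps K) (o := fun _ => PUnit.unit)
    (scaleLin K s t) (zeroBilin K) (fun _ _ f => mem_grZero K (R := TrivSqZeroExt K (K × K)) f)
    (fun f => mem_grZero K (scaleLin K s t f))
    -- A quadratic component has degree -1, where K[ε₁, ε₂] is zero, so the zero pairing is the only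
    -- choice.
    (fun _ _ => (grZero K (TrivSqZeroExt K (K × K)) (-1)).zero_mem)
    (scaleLin_mul K s t)
    (fun f _ h => (by simp : (0 : TrivSqZeroExt K (K × K)) + scaleLin K s t h * 0 =
      0 + 0 * scaleLin K s t f))
    (fun _ _ _ _ => zero_mul (0 : TrivSqZeroExt K (K × K)))

lemma scaleFunctor₀_strictlyUnital (s t : K) : (scaleFunctor₀ K s t).StrictlyUnital where
  map_one X := (by ext <;> simp [scaleLin_apply] : scaleLin K s t 1 = 1)
  map_insert_one a q h :=
    GradedCat.pairMap_insert_one (P := twoEps K) (Q := twoEps K) (o := fun _ => PUnit.unit)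
      (scaleLin K s t) (zeroBilin K) (fun _ => rfl) (fun _ => rfl) a q h

/-- The functor `scaleFunctor₀ K s t`, as a morphism. -/
def scaleFunctor (s t : K) : (twoEps K).toACat ⟶ (twoEps K).toACat :=
  ⟨scaleFunctor₀ K s t, scaleFunctor₀_strictlyUnital K s t⟩

lemma scaleFunctor₀_map_eq_zero (s t : K) {X Y : (twoEps K).Ob} (p : Chain (twoEps K).Hom X Y)
    (hp : 1 < p.length) : (scaleFunctor₀ K s t).map p = 0 := by
  cases p with
  | nil => rfl
  | cons p f =>
  cases p with
  | nil => simp at hp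
  -- Length two gives a value of the zero pairing, and greater length falls into the default case of
  -- `pairMap`.
  | cons p g => cases p <;> rfl

/-- Scaling functors are strict and sit in degree zero, so precomposing with one is substitution in
each entry, without signs. This reduces every composite below to a comparison of linear and
quadratic parts. -/
lemma scaleFunctor₀_comp (s t : K) {C : NUAInfCat K}
    (G : NUAInfFunctor (twoEps K).toACat.toNUAInfCat C) {X Y : (twoEps K).Ob}
    (p : Chain (twoEps K).Hom X Y) :
    ((scaleFunctor₀ K s t).comp G).map p =
      G.map (Chain.mapArrows (V := (twoEps K).Hom) (W := (twoEps K).Hom)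
        (o := fun _ => PUnit.unit) (scaleLin K s t) p) :=
  NUAInfFunctor.comp_map_of_strict
    (fun _ _ f => mem_grZero K (R := TrivSqZeroExt K (K × K)) f)
    (fun _ _ f => mem_grZero K (R := TrivSqZeroExt K (K × K)) f) (scaleFunctor₀ K s t)
    (scaleFunctor₀_map_eq_zero K s t) G p

/-- The family of functors to K[ε] indexed by c is stable under scaling: the linear part ignores ε₁
and ε₂, and the quadratic part is multiplied by s t. When s t = 0 the parameter c is therefore lost,
which is what makes the projections onto the two axes equalize the pair. -/
lemma scaleFunctor₀_comp_epsFunctor₀ (s t c : K) :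
    (scaleFunctor₀ K s t).comp (epsFunctor₀ K c) = epsFunctor₀ K (c * (s * t)) := by
  refine NUAInfFunctor.ext_map rfl fun X Y p => heq_of_eq ?_
  refine (scaleFunctor₀_comp K s t _ p).trans ?_
  -- The cases are lengths zero, one, two, and at least three; both functors vanish at length zero
  -- and beyond length two.
  match p with
  | .nil _ => rfl
  | .cons (.nil _) f => exact epsLin_scaleLin K s t f
  | .cons (.cons (.nil _) f) g => exact epsBilin_scaleLin K s t c f g
  | .cons (.cons (.cons _ _) _) _ => rfl

/-- All scalings agree on the constants. It is used to force two factorizations through an equalizer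
to land on the same object. -/
lemma scaleFunctor₀_zero_comp (s t : K) :
    (scaleFunctor₀ K 0 0).comp (scaleFunctor₀ K s t) = scaleFunctor₀ K 0 0 := by
  refine NUAInfFunctor.ext_map rfl fun X Y p => heq_of_eq ?_
  refine (scaleFunctor₀_comp K 0 0 _ p).trans ?_
  match p with
  | .nil _ => rfl
  | .cons (.nil _) f => exact scaleLin_zero_apply K s t f
  -- Both sides are values of the zero pairing.
  | .cons (.cons (.nil _) f) g => rfl
  | .cons (.cons (.cons _ _) _) _ => rfl

/-! ### The quadratic obstruction -/

variable {K}

/-- If `e` equalizes `F₁` and `F₂`, then the product of the coefficient of `ε₂` in `e¹ x` and the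
coefficient of `ε₁` in `e¹ y` vanishes for all composable arrows `x` and `y`. -/
lemma epsBilin_eq_zero_of_comp_eq {E : NUAInfCat K}
    (e : NUAInfFunctor E (twoEps K).toACat.toNUAInfCat)
    (h : e.comp (epsFunctor₀ K 0) = e.comp (epsFunctor₀ K 1)) {X Y Z : E.Ob}
    (x : E.Hom X Y) (y : E.Hom Y Z) :
    epsBilin K 1 (e.map ((Chain.nil X).cons x)) (e.map ((Chain.nil Y).cons y)) = 0 := by
  -- Rewriting by `h` changes the object map and hence the type of the value, so the equality is
  -- first heterogeneous. It becomes an ordinary one because K[ε] has a single hom space.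
  have hmap : ∀ p : Chain E.Hom X Z, HEq ((e.comp (epsFunctor₀ K 0)).map p)
      ((e.comp (epsFunctor₀ K 1)).map p) := fun p => by rw [h]
  have h2 := eq_of_heq (hmap (((Chain.nil X).cons x).cons y))
  have h3 := (NUAInfFunctor.comp_map_two e (epsFunctor₀ K 0) x y).symm.trans
    (h2.trans (NUAInfFunctor.comp_map_two e (epsFunctor₀ K 1) x y))
  -- The second summand, F¹ applied to the quadratic part of `e`, is the same on both sides, because
  -- F¹ does not depend on c. Cancelling it isolates the pairing.
  change epsBilin K 0 (e.map ((Chain.nil X).cons x)) (e.map ((Chain.nil Y).cons y)) +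
    epsLin K (e.map (((Chain.nil X).cons x).cons y)) =
    epsBilin K 1 (e.map ((Chain.nil X).cons x)) (e.map ((Chain.nil Y).cons y)) +
    epsLin K (e.map (((Chain.nil X).cons x).cons y)) at h3
  exact (add_right_cancel h3).symm.trans (epsBilin_zero K _ _)

/-- No functor `e` equalizing `F₁` and `F₂` factors both projections `(ε₁, ε₂) ↦ (ε₁, 0)` and
`(ε₁, ε₂) ↦ (0, ε₂)` in such a way that the factorizations agree on the constants. -/
lemma not_exists_equalizing_factorization {E : NUAInfCat K}
    (e : NUAInfFunctor E (twoEps K).toACat.toNUAInfCat)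
    (h : e.comp (epsFunctor₀ K 0) = e.comp (epsFunctor₀ K 1))
    (l₁ l₂ : NUAInfFunctor (twoEps K).toACat.toNUAInfCat E)
    (h₁ : l₁.comp e = scaleFunctor₀ K 1 0) (h₂ : l₂.comp e = scaleFunctor₀ K 0 1)
    (h₀ : (scaleFunctor₀ K 0 0).comp l₁ = (scaleFunctor₀ K 0 0).comp l₂) : False := by
  -- This is the only use of `h₀`: agreement on the constants gives agreement on the unique object,
  -- so arrows from the two images can be composed.
  have hobj : l₁.obj PUnit.unit = l₂.obj PUnit.unit :=
    congrFun (congrArg NUAInfFunctor.obj h₀) PUnit.unit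
  -- The two endomorphisms live on objects that are only propositionally equal. Stating the
  -- vanishing for variable objects `X` and `Y` allows the equality to be substituted away instead
  -- of transporting arrows along it.
  have key : ∀ {X Y : E.Ob} (_ : X = Y) (y : E.Hom X X) (x : E.Hom Y Y),
      epsBilin K 1 (e.map ((Chain.nil Y).cons x)) (e.map ((Chain.nil X).cons y)) = 0 := by
    rintro X _ rfl y x
    exact epsBilin_eq_zero_of_comp_eq e h x y
  -- On a chain of length one a composite is the composite of the linear parts, so the linear part
  -- of a factorization `l` is a lift of the scaling map through that of `e`.
  have hl : ∀ (l : NUAInfFunctor (twoEps K).toACat.toNUAInfCat E) (s t : K)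
      (_ : l.comp e = scaleFunctor₀ K s t) (f : TrivSqZeroExt K (K × K)),
      e.map ((Chain.nil _).cons (l.map (Y := PUnit.unit) ((Chain.nil PUnit.unit).cons f))) =
        scaleLin K s t f := by
    intro l s t hl f
    have hm : HEq ((l.comp e).map (Y := PUnit.unit) ((Chain.nil PUnit.unit).cons f))
        ((scaleFunctor₀ K s t).map (Y := PUnit.unit) ((Chain.nil PUnit.unit).cons f)) := by rw [hl]
    exact (NUAInfFunctor.comp_map_one l e f).symm.trans (eq_of_heq hm)
  -- The earlier arrow is the lift of ε₂ through `l₂` and the later one the lift of ε₁ through `l₁`.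
  -- This is the order in which the pairing is nonzero, as it corresponds to F²(ε₁, ε₂).
  have h3 := key hobj
    (l₁.map (Y := PUnit.unit) ((Chain.nil PUnit.unit).cons (inr (1, 0) : TrivSqZeroExt K (K × K))))
    (l₂.map (Y := PUnit.unit) ((Chain.nil PUnit.unit).cons (inr (0, 1) : TrivSqZeroExt K (K × K))))
  have h4 : epsBilin K 1 (scaleLin K 0 1 (inr (0, 1))) (scaleLin K 1 0 (inr (1, 0))) = 0 :=
    (congrArg₂ (fun a b => epsBilin K 1 a b) (hl l₂ 0 1 h₂ _) (hl l₁ 1 0 h₁ _)).symm.trans h3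
  -- The ε-coefficient of the pairing of ε₁ with ε₂ is 1, so this reads 1 = 0 in K.
  have h5 := congrArg TrivSqZeroExt.snd h4
  simp [epsBilin_apply, scaleLin_apply] at h5

/-! ### Absence of equalizers -/

variable (K)

/-- Both composites have quadratic coefficient zero, being 0 · (s t) and 1 · (s t). -/
lemma scaleFunctor_comp_epsFunctor {s t : K} (h : s * t = 0) :
    scaleFunctor K s t ≫ epsFunctor K 0 = scaleFunctor K s t ≫ epsFunctor K 1 := by
  refine Subtype.ext ?_
  change (scaleFunctor₀ K s t).comp (epsFunctor₀ K 0) = (scaleFunctor₀ K s t).comp (epsFunctor₀ K 1)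
  rw [scaleFunctor₀_comp_epsFunctor₀, scaleFunctor₀_comp_epsFunctor₀, h, mul_zero, mul_zero]

lemma scaleFunctor_zero_comp (s t : K) :
    scaleFunctor K 0 0 ≫ scaleFunctor K s t = scaleFunctor K 0 0 :=
  Subtype.ext (scaleFunctor₀_zero_comp K s t)

/-- The two functors `K[ε₁, ε₂] → K[ε]` have no equalizer among strictly unital categories. -/
lemma not_hasEqualizer_epsFunctor :
    ¬ Limits.HasEqualizer (epsFunctor K 0) (epsFunctor K 1) := by
  intro _
  have hc := Limits.equalizer.condition (epsFunctor K 0) (epsFunctor K 1)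
  -- The pairs (1, 0) and (0, 1) are the two axes of the cone s t = 0. Each projection equalizes,
  -- although the sum of their linear parts on the span of ε₁, ε₂ is the identity, which does not.
  have h₁ := scaleFunctor_comp_epsFunctor K (mul_zero 1)
  have h₂ := scaleFunctor_comp_epsFunctor K (zero_mul 1)
  -- The map out of an equalizer is a monomorphism, and after it both sides become scaling by (0,
  -- 0).
  have h₀ : scaleFunctor K 0 0 ≫ Limits.equalizer.lift _ h₁ =
      scaleFunctor K 0 0 ≫ Limits.equalizer.lift _ h₂ := by
    refine Limits.equalizer.hom_ext ?_
    simp only [Category.assoc, Limits.equalizer.lift_ι, scaleFunctor_zero_comp]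
  exact not_exists_equalizing_factorization _ (congrArg Subtype.val hc) _ _
    (congrArg Subtype.val (Limits.equalizer.lift_ι _ h₁))
    (congrArg Subtype.val (Limits.equalizer.lift_ι _ h₂)) (congrArg Subtype.val h₀)

/-- The two functors `K[ε₁, ε₂] → K[ε]` have no equalizer among cohomologically unital
categories. -/
lemma not_hasEqualizer_toACatC_map_epsFunctor :
    ¬ Limits.HasEqualizer
      ((ACat.toACatC K).map (epsFunctor K 0)) ((ACat.toACatC K).map (epsFunctor K 1)) := by
  intro _
  have hc := Limits.equalizer.condition ((ACat.toACatC K).map (epsFunctor K 0))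
    ((ACat.toACatC K).map (epsFunctor K 1))
  -- Only equations between morphisms are carried along the inclusion. Nothing is claimed about its
  -- effect on limits: the equalizer is taken among cohomologically unital categories and may have
  -- no strict units.
  have hs : ∀ {s t : K}, s * t = 0 →
      (ACat.toACatC K).map (scaleFunctor K s t) ≫ (ACat.toACatC K).map (epsFunctor K 0) =
        (ACat.toACatC K).map (scaleFunctor K s t) ≫ (ACat.toACatC K).map (epsFunctor K 1) := by
    intro s t h
    rw [← Functor.map_comp, ← Functor.map_comp, scaleFunctor_comp_epsFunctor K h]
  have h₁ := hs (mul_zero 1)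
  have h₂ := hs (zero_mul 1)
  have h₀ : (ACat.toACatC K).map (scaleFunctor K 0 0) ≫ Limits.equalizer.lift _ h₁ =
      (ACat.toACatC K).map (scaleFunctor K 0 0) ≫ Limits.equalizer.lift _ h₂ := by
    refine Limits.equalizer.hom_ext ?_
    simp only [Category.assoc, Limits.equalizer.lift_ι, ← Functor.map_comp,
      scaleFunctor_zero_comp]
  -- Forgetting unitality on all the morphisms puts the data in the non-unital setting, where the
  -- contradiction was obtained.
  exact not_exists_equalizing_factorization _ (congrArg Subtype.val hc) _ _
    (congrArg Subtype.val (Limits.equalizer.lift_ι _ h₁))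
    (congrArg Subtype.val (Limits.equalizer.lift_ι _ h₂)) (congrArg Subtype.val h₀)

end dualNumbers

/-! ### The main theorem -/

theorem proposition1p12 (K : Type u) [Field K] :
    (¬ Limits.HasEqualizer (epsFunctor K 0) (epsFunctor K 1)) ∧
    (¬ Limits.HasEqualizer
      ((ACat.toACatC K).map (epsFunctor K 0)) ((ACat.toACatC K).map (epsFunctor K 1))) ∧
    IsEmpty (HomotopicalAlgebra.ModelCategory (ACat K)) ∧
    IsEmpty (HomotopicalAlgebra.ModelCategory (ACatC K)) := by
  refine ⟨not_hasEqualizer_epsFunctor K, not_hasEqualizer_toACatC_map_epsFunctor K,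
    ⟨fun h => not_hasEqualizer_epsFunctor K ?_⟩,
    ⟨fun h => not_hasEqualizer_toACatC_map_epsFunctor K ?_⟩⟩
  -- The axiom `cm1a` asks for finite limits only, and an equalizer is one of these.
  · have := h.cm1a
    infer_instance
  · have := h.cm1a
    infer_instance
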